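/- Let $X$ be a set with a $\sigma$-algebra $\Omega$. All vector spaces are real, and all partially ordered vector spaces are Archimedean with proper, not necessarily generating, positive cone. Let $\mathcal A$ be a partially ordered algebra, i.e. an associative, not necessarily unital, algebra that is a partially ordered vector space and in which products of positive elements are positive. Suppose that $\mathcal A$ is $\sigma$-monotone complete (every increasing sequence that is bounded from above has a supremum), and that its multiplication is $\sigma$-monotone continuous ($0\le a_n\uparrow a$ implies $ba_n\uparrow ba$ and $a_nb\uparrow ab$ for all $b\ge 0$). Let $\mu:\Omega\to\mathcal A^+$ be a finite spectral measure, i.e. $\mu(\emptyset)=0$, $\mu(\bigcup_n S_n)=\bigvee_N\sum_{n=1}^N\mu(S_n)$ for pairwise disjoint sequences $(S_n)$ in $\Omega$, and $\mu(S\cap T)=\mu(S)\mu(T)$ for all $S,T\in\Omega$. For $\varphi=\sum_i r_i\chi_{S_i}$ with finitely many $r_i\ge0$ and pairwise disjoint $S_i\in\Omega$, put $\int\varphi\,d\mu=\sum_i r_i\mu(S_i)$; for measurable $f:X\to[0,\infty)$, put $\int f\,d\mu=\bigvee_n\int\varphi_n\,d\mu$ where $\varphi_n$ are such functions with $\varphi_n\uparrow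 f$ pointwise (this is $\infty$ if the sequence of integrals is not bounded from above). Let $\mathcal L^1$ be the space of measurable $f:X\to\mathbb R$ for which $\int|f|\,d\mu$ is finite, let $I_\mu:\mathcal L^1\to\mathcal A$ be the resulting order integral $I_\mu(f)=\int f^+d\mu-\int f^-d\mu$, let $\mathcal N\subseteq\mathcal L^1$ be the functions that vanish $\mu$-almost everywhere, and let $\mathrm L^1=\mathcal L^1/\mathcal N$ with the quotient ordering. A linear map $T:E\to F$ between partially ordered vector spaces preserves the lattice structure when, for all $x,y\in E$ such that $x\vee y$ exists in $E$, $Tx\vee Ty$ exists in $F$ and equals $T(x\vee y)$. A Riesz algebra is a partially ordered algebra that is a lattice; a Riesz algebra homomorphism is an algebra homomorphism that is also a vector lattice homomorphism. A positive operator $T$ is ($\sigma$-)order continuous when $Tx_\lambda\downarrow0$ for every net (sequence) $x_\lambda\downarrow0$. A partially ordered vector space is monotone complete when every increasing net that is bounded from above has a supremum; it has the countable sup property when, for every net $0\le x_\lambda\uparrow x$, there are at most countably many indices $\lambda_n$ with $x=\sup_n x_{\lambda_n}$. Then: 1. $I_\mu(f)\in\mu(X)\mathcal A\mu(X)$ for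 $f\in\mathcal L^1$. 2. Both maps $I_\mu:\mathcal L^1\to\mu(X)\mathcal A$ and $I_\mu:\mathcal L^1\to\mathcal A\mu(X)$ preserve the lattice structure, where $\mu(X)\mathcal A$ and $\mathcal A\mu(X)$ have the ordering inherited from $\mathcal A$. 3. $\mathcal L^1$, with pointwise operations and ordering, is a commutative unital Riesz algebra. 4. With the multiplication and the ordering inherited from $\mathcal A$, $I_\mu(\mathcal L^1)$ is a commutative unital Riesz algebra with $\mu(X)$ as its positive identity element, and $I_\mu:\mathcal L^1\to I_\mu(\mathcal L^1)$ is a surjective unital Riesz algebra homomorphism. 5. The kernel of $I_\mu:\mathcal L^1\to\mathcal A$ is $\mathcal N$; $\mathrm L^1$ is a commutative unital Riesz algebra as a quotient of $\mathcal L^1$, and the induced map $I_\mu:\mathrm L^1\to I_\mu(\mathcal L^1)$ is an isomorphism of Riesz algebras. The space $\mathrm L^1$ is $\sigma$-Dedekind complete (every non-empty countable subset that is bounded from above has a supremum), and $I_\mu:\mathrm L^1\to\mathcal A$ is $\sigma$-order continuous. If, in addition, $\mathcal A$ is monotone complete and has the countable sup property, then $\mathrm L^1$ is Dedekind complete (every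 non-empty subset that is bounded from above has a supremum), it has the countable sup property, and $I_\mu:\mathrm L^1\to\mathcal A$ is order continuous. -/

import Mathlib

open Set Filter Topology MeasureTheory
open scoped NNReal ENNReal

noncomputable section

namespace OrderInt

/-! ### Partially ordered vector spaces -/

/-- A partially ordered real vector space; as usual, it is required to be Archimedean. -/
class PartiallyOrderedVectorSpace (E : Type*) [AddCommGroup E] [Module ℝ E] [PartialOrder E] :
    Prop extends IsOrderedAddMonoid E, IsOrderedModule ℝ E where
  archimedean : ∀ x : E, 0 ≤ x → ∀ r : ℕ → ℝ, Antitone r → IsGLB (range r) 0 →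
    IsGLB (range fun n => r n • x) 0

/-- Every increasing sequence that is bounded from above has a supremum. -/
class SigmaMonotoneComplete (E : Type*) [PartialOrder E] : Prop where
  exists_isLUB : ∀ x : ℕ → E, Monotone x → BddAbove (range x) → ∃ a, IsLUB (range x) a

/-- Every increasing net that is bounded from above has a supremum. The range of an increasing net
is a non-empty upward directed set, and a non-empty upward directed set is an increasing net indexed
by itself. -/
def MonotoneComplete (E : Type*) [PartialOrder E] : Prop :=
  ∀ D : Set E, D.Nonempty → DirectedOn (· ≤ ·) D → BddAbove D → ∃ a, IsLUB D a

def DedekindComplete (E : Type*) [PartialOrder E] : Prop :=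
  ∀ S : Set E, S.Nonempty → BddAbove S → ∃ a, IsLUB S a

def SigmaDedekindComplete (E : Type*) [PartialOrder E] : Prop :=
  ∀ S : Set E, S.Nonempty → S.Countable → BddAbove S → ∃ a, IsLUB S a

/-- Whenever a net in the positive cone increases to `x`, at most countably many of its members have
supremum `x`. -/
def CountableSupProperty (E : Type*) [AddCommGroup E] [PartialOrder E] : Prop :=
  ∀ (D : Set E) (x : E), D.Nonempty → DirectedOn (· ≤ ·) D → (∀ d ∈ D, 0 ≤ d) → IsLUB D x →
    ∃ C ⊆ D, C.Nonempty ∧ C.Countable ∧ IsLUB C x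

/-- A Riesz space: a partially ordered vector space that is a lattice. -/
structure IsRieszSpace (E : Type*) [AddCommGroup E] [Module ℝ E] [PartialOrder E] : Prop where
  povs : PartiallyOrderedVectorSpace E
  exists_sup : ∀ x y : E, ∃ z, IsLUB {x, y} z
  exists_inf : ∀ x y : E, ∃ z, IsGLB {x, y} z

section Operators

variable {E F : Type*} [AddCommGroup E] [Module ℝ E] [PartialOrder E]
  [AddCommGroup F] [Module ℝ F] [PartialOrder F]

/-- Whenever `x ∨ y` exists in `E`, then `T x ∨ T y` exists in `F` and equals `T (x ∨ y)`. Between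
Riesz spaces, these are the vector lattice homomorphisms. -/
def PreservesLatticeStructure (T : E →ₗ[ℝ] F) : Prop :=
  ∀ x y z : E, IsLUB {x, y} z → IsLUB {T x, T y} (T z)

/-- A positive operator `T` such that `T x_n ↓ 0` whenever `x_n ↓ 0`. -/
def IsPositiveSigmaOrderContinuous (T : E →ₗ[ℝ] F) : Prop :=
  (∀ x, 0 ≤ x → 0 ≤ T x) ∧
    ∀ x : ℕ → E, Antitone x → IsGLB (range x) 0 → IsGLB (range fun n => T (x n)) 0

/-- A positive operator `T` such that `T x_λ ↓ 0` whenever `x_λ ↓ 0` for a net. -/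
def IsPositiveOrderContinuous (T : E →ₗ[ℝ] F) : Prop :=
  (∀ x, 0 ≤ x → 0 ≤ T x) ∧
    ∀ D : Set E, D.Nonempty → DirectedOn (· ≥ ·) D → IsGLB D 0 → IsGLB (T '' D) 0

/-- The bilinear map `m` is a multiplication that makes `E` a commutative Riesz algebra with
positive identity element `e`. -/
structure IsCommUnitalRieszAlgebra (m : E →ₗ[ℝ] E →ₗ[ℝ] E) (e : E) : Prop where
  riesz : IsRieszSpace E
  assoc : ∀ a b c, m (m a b) c = m a (m b c)
  comm : ∀ a b, m a b = m b a
  mul_nonneg : ∀ a b, 0 ≤ a → 0 ≤ b → 0 ≤ m a b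
  one_mul : ∀ a, m e a = a
  one_nonneg : 0 ≤ e

/-- A unital Riesz algebra homomorphism, for the multiplications `m`, `m'` and identities
`e`, `e'`. -/
structure IsUnitalRieszAlgebraHom (m : E →ₗ[ℝ] E →ₗ[ℝ] E) (e : E) (m' : F →ₗ[ℝ] F →ₗ[ℝ] F) (e' : F)
    (T : E →ₗ[ℝ] F) : Prop where
  map_lattice : PreservesLatticeStructure T
  map_mul : ∀ a b, T (m a b) = m' (T a) (T b)
  map_one : T e = e'

end Operators

/-! ### Partially ordered algebras -/

/-- A partially ordered algebra (real, associative, not necessarily unital). -/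
class PartiallyOrderedAlgebra (A : Type*) [NonUnitalRing A] [Module ℝ A] [PartialOrder A] : Prop
    extends PartiallyOrderedVectorSpace A, IsScalarTower ℝ A A, SMulCommClass ℝ A A where
  mul_nonneg : ∀ a b : A, 0 ≤ a → 0 ≤ b → 0 ≤ a * b

/-- If `0 ≤ a_n ↑ a`, then `b a_n ↑ b a` and `a_n b ↑ a b` for all `b ≥ 0`. -/
def SigmaMonotoneContinuousMul (A : Type*) [NonUnitalRing A] [PartialOrder A] : Prop :=
  ∀ (x : ℕ → A) (a b : A), (∀ n, 0 ≤ x n) → Monotone x → IsLUB (range x) a → 0 ≤ b →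
    (Monotone (fun n => b * x n) ∧ IsLUB (range fun n => b * x n) (b * a)) ∧
      (Monotone (fun n => x n * b) ∧ IsLUB (range fun n => x n * b) (a * b))

/-! ### Auxiliary facts on suprema -/

section Aux

variable {E : Type*} [AddCommGroup E] [Module ℝ E] [PartialOrder E] [PartiallyOrderedVectorSpace E]

theorem isLUB_add {x y : ℕ → E} {a b : E} (hx : Monotone x) (hy : Monotone y)
    (ha : IsLUB (range x) a) (hb : IsLUB (range y) b) :
    IsLUB (range fun n => x n + y n) (a + b) := by
  constructor
  · rintro _ ⟨n, rfl⟩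
    exact add_le_add (ha.1 ⟨n, rfl⟩) (hb.1 ⟨n, rfl⟩)
  · intro c hc
    have h1 : ∀ n m, x n + y m ≤ c := fun n m =>
      (add_le_add (hx (le_max_left n m)) (hy (le_max_right n m))).trans (hc ⟨max n m, rfl⟩)
    have h2 : ∀ m, a ≤ c - y m := fun m => ha.2 (by
      rintro _ ⟨n, rfl⟩
      exact le_sub_iff_add_le.2 (h1 n m))
    have h3 : b ≤ c - a := hb.2 (by
      rintro _ ⟨m, rfl⟩
      exact le_sub_comm.1 (h2 m))
    rw [add_comm]
    exact le_sub_iff_add_le.1 h3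

theorem isLUB_smul {x : ℕ → E} {a : E} {c : ℝ} (hc : 0 ≤ c) (ha : IsLUB (range x) a) :
    IsLUB (range fun n => c • x n) (c • a) := by
  rcases hc.eq_or_lt with rfl | hc
  · simp
  constructor
  · rintro _ ⟨n, rfl⟩
    exact smul_le_smul_of_nonneg_left (ha.1 ⟨n, rfl⟩) hc.le
  · intro b hb
    have : a ≤ c⁻¹ • b := ha.2 (by
      rintro _ ⟨n, rfl⟩
      have := smul_le_smul_of_nonneg_left (hb ⟨n, rfl⟩) (inv_nonneg.2 hc.le)
      simpa [smul_smul, inv_mul_cancel₀ hc.ne'] using this)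
    have := smul_le_smul_of_nonneg_left this hc.le
    simpa [smul_smul, mul_inv_cancel₀ hc.ne'] using this

theorem isLUB_sum {ι : Type*} (s : Finset ι) {x : ι → ℕ → E} {a : ι → E}
    (hx : ∀ i, Monotone (x i)) (ha : ∀ i, IsLUB (range (x i)) (a i)) :
    IsLUB (range fun n => ∑ i ∈ s, x i n) (∑ i ∈ s, a i) := by
  classical
  induction s using Finset.induction_on with
  | empty => simp
  | insert i s hi ih =>
    simp only [Finset.sum_insert hi]
    exact isLUB_add (hx i) (fun m n h => Finset.sum_le_sum fun j _ => hx j h) (ha i) ih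

theorem le_of_forall_smul_le {x a : E} (hx : 0 ≤ x)
    (h : ∀ c : ℝ, 0 < c → c < 1 → c • x ≤ a) : x ≤ a := by
  have hg := PartiallyOrderedVectorSpace.archimedean x hx (fun n : ℕ => 1 / ((n : ℝ) + 2))
    (fun m n hmn => one_div_le_one_div_of_le (by positivity) (by
      have : (m : ℝ) ≤ n := by exact_mod_cast hmn
      linarith)) (by
      constructor
      · rintro _ ⟨n, rfl⟩
        positivity
      · intro b hb
        by_contra hb0
        obtain ⟨n, hn⟩ := exists_nat_one_div_lt (not_le.1 hb0)
        have h1 : b ≤ 1 / ((n : ℝ) + 2) := hb ⟨n, rfl⟩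
        have h2 : 1 / ((n : ℝ) + 2) ≤ 1 / ((n : ℝ) + 1) :=
          one_div_le_one_div_of_le (by positivity) (by linarith)
        linarith)
  have : x - a ≤ 0 := hg.2 (by
    rintro _ ⟨n, rfl⟩
    have hn : (0 : ℝ) < (n : ℝ) + 2 := by positivity
    have h1 : 1 / ((n : ℝ) + 2) < 1 := by
      rw [div_lt_one hn]
      have : (0 : ℝ) ≤ n := by positivity
      linarith
    have := h (1 - 1 / ((n : ℝ) + 2)) (by linarith) (by
      have : 0 < 1 / ((n : ℝ) + 2) := by positivity
      linarith)
    rw [sub_smul, one_smul] at this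
    exact sub_le_comm.1 this)
  exact sub_nonpos.1 this

end Aux

/-! ### Finite measures with values in the positive cone -/

/-- A finite measure on the `σ`-algebra of `X`, with values in the positive cone of `E`. Only the
values on measurable sets matter. -/
structure FiniteConeMeasure (X E : Type*) [MeasurableSpace X] [AddCommGroup E] [PartialOrder E] where
  toFun : Set X → E
  nonneg : ∀ S, MeasurableSet S → 0 ≤ toFun S
  empty : toFun ∅ = 0
  iUnion : ∀ S : ℕ → Set X, (∀ n, MeasurableSet (S n)) → Pairwise (fun i j => Disjoint (S i) (S j)) →
    IsLUB (range fun N => ∑ n ∈ Finset.range (N + 1), toFun (S n)) (toFun (⋃ n, S n))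

instance (X E : Type*) [MeasurableSpace X] [AddCommGroup E] [PartialOrder E] :
    CoeFun (FiniteConeMeasure X E) (fun _ => Set X → E) := ⟨FiniteConeMeasure.toFun⟩

/-- A finite measure with values in an algebra is spectral when it is multiplicative on
intersections. -/
def FiniteConeMeasure.IsSpectral {X A : Type*} [MeasurableSpace X] [NonUnitalRing A]
    [PartialOrder A] (μ : FiniteConeMeasure X A) : Prop :=
  ∀ S T : Set X, MeasurableSet S → MeasurableSet T → μ (S ∩ T) = μ S * μ T

namespace FiniteConeMeasure

variable {X E : Type*} [MeasurableSpace X] [AddCommGroup E] [Module ℝ E] [PartialOrder E]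

/-- The order integral `∑ r μ(φ = r)` of an elementary function `φ : X → [0, ∞)`. -/
def simpleIntegral (μ : FiniteConeMeasure X E) (φ : SimpleFunc X ℝ≥0) : E :=
  ∑ r ∈ φ.range, (r : ℝ) • μ (φ ⁻¹' {r})

/-- The elementary functions `φ n` increase pointwise to `f`. -/
def Approximates (φ : ℕ → SimpleFunc X ℝ≥0) (f : X → ℝ) : Prop :=
  Monotone φ ∧ ∀ x, Tendsto (fun n => (φ n x : ℝ)) atTop (𝓝 (f x))

/-- The order integral of the function `f ≥ 0` is the finite element `a`: it is the supremum of the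
integrals of elementary functions that increase pointwise to `f`. -/
def HasPosIntegral (μ : FiniteConeMeasure X E) (f : X → ℝ) (a : E) : Prop :=
  ∃ φ : ℕ → SimpleFunc X ℝ≥0, Approximates φ f ∧ IsLUB (range fun n => μ.simpleIntegral (φ n)) a

variable [PartiallyOrderedVectorSpace E]

theorem union (μ : FiniteConeMeasure X E) {S T : Set X} (hS : MeasurableSet S)
    (hT : MeasurableSet T) (h : Disjoint S T) : μ (S ∪ T) = μ S + μ T := by
  let U : ℕ → Set X := fun n => if n = 0 then S else if n = 1 then T else ∅
  have hU : ∀ n, MeasurableSet (U n) := by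
    intro n
    simp only [U]
    split_ifs <;> simp [hS, hT]
  have hd : Pairwise (fun i j => Disjoint (U i) (U j)) := by
    intro i j hij
    simp only [U]
    split_ifs <;> simp_all [disjoint_comm]
  have h1 := μ.iUnion U hU hd
  have h2 : (⋃ n, U n) = S ∪ T := by
    ext x
    simp only [mem_iUnion, mem_union]
    constructor
    · rintro ⟨n, hn⟩
      simp only [U] at hn
      split_ifs at hn <;> simp_all
    · rintro (hx | hx)
      · exact ⟨0, by simpa [U] using hx⟩
      · exact ⟨1, by simpa [U] using hx⟩
  have h3 : ∀ N, ∑ n ∈ Finset.range (N + 2), μ (U n) = μ S + μ T := by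
    intro N
    induction N with
    | zero => simp [Finset.sum_range_succ, U]
    | succ N ih =>
      rw [Finset.sum_range_succ, ih]
      simp [U, μ.empty]
  rw [h2] at h1
  refine h1.unique ⟨?_, fun c hc => ?_⟩
  · rintro _ ⟨N, rfl⟩
    rcases N with _ | N
    · simpa [U] using μ.nonneg T hT
    · exact (h3 N).le
  · have := hc ⟨1, rfl⟩
    simp only [] at this
    rwa [h3 0] at this

theorem mono (μ : FiniteConeMeasure X E) {S T : Set X} (hS : MeasurableSet S)
    (hT : MeasurableSet T) (h : S ⊆ T) : μ S ≤ μ T := by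
  have := μ.union hS (hT.diff hS) disjoint_sdiff_right
  rw [union_sdiff_cancel h] at this
  rw [this]
  exact le_add_of_nonneg_right (μ.nonneg _ (hT.diff hS))

theorem biUnion (μ : FiniteConeMeasure X E) {ι : Type*} (s : Finset ι) {S : ι → Set X}
    (hS : ∀ i, MeasurableSet (S i)) (hd : ∀ i ∈ s, ∀ j ∈ s, i ≠ j → Disjoint (S i) (S j)) :
    μ (⋃ i ∈ s, S i) = ∑ i ∈ s, μ (S i) := by
  classical
  induction s using Finset.induction_on with
  | empty => simp [μ.empty]
  | insert i s hi ih =>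
    rw [Finset.set_biUnion_insert, μ.union (hS i) (Finset.measurableSet_biUnion _ fun j _ => hS j),
      Finset.sum_insert hi, ih fun j hj k hk => hd j (by simp [hj]) k (by simp [hk])]
    refine disjoint_iUnion₂_right.2 fun j hj => hd i (by simp) j (by simp [hj]) ?_
    rintro rfl
    exact hi hj

theorem sum_inter (μ : FiniteConeMeasure X E) {ι : Type*} (s : Finset ι) {S : ι → Set X}
    (hS : ∀ i, MeasurableSet (S i)) (hd : ∀ i ∈ s, ∀ j ∈ s, i ≠ j → Disjoint (S i) (S j))
    {T : Set X} (hT : MeasurableSet T) (hTS : T ⊆ ⋃ i ∈ s, S i) :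
    μ T = ∑ i ∈ s, μ (S i ∩ T) := by
  rw [← μ.biUnion s (fun i => (hS i).inter hT)
    (fun i hi j hj hij => (hd i hi j hj hij).mono inter_subset_left inter_subset_left)]
  congr 1
  rw [← iUnion₂_inter, inter_eq_right.2 hTS]

/-- Continuity from below. -/
theorem isLUB_inter (μ : FiniteConeMeasure X E) {B : ℕ → Set X} (hB : ∀ n, MeasurableSet (B n))
    (hm : Monotone B) (hU : ⋃ n, B n = univ) {S : Set X} (hS : MeasurableSet S) :
    IsLUB (range fun n => μ (S ∩ B n)) (μ S) := by
  have hd : ∀ n, MeasurableSet (S ∩ disjointed B n) := fun n =>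
    hS.inter (MeasurableSet.disjointed hB n)
  have hdd : Pairwise (fun i j => Disjoint (S ∩ disjointed B i) (S ∩ disjointed B j)) :=
    fun i j hij => (disjoint_disjointed B hij).mono inter_subset_right inter_subset_right
  have h := μ.iUnion _ hd hdd
  have h1 : (⋃ n, S ∩ disjointed B n) = S := by
    rw [← inter_iUnion, iUnion_disjointed, hU, inter_univ]
  have h2 : ∀ N, ∑ n ∈ Finset.range (N + 1), μ (S ∩ disjointed B n) = μ (S ∩ B N) := by
    intro N
    rw [← μ.biUnion _ hd fun i _ j _ hij => hdd hij]
    congr 1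
    rw [← inter_iUnion₂]
    congr 1
    have := Set.ext_iff.1 (partialSups_disjointed B ▸ partialSups_eq_biUnion_range (disjointed B) N)
    rw [hm.partialSups_eq] at this
    ext x
    rw [this x]
  rw [h1] at h
  simpa only [h2] using h

/-- The integral of an elementary function, calculated with an arbitrary disjoint
representation. -/
theorem simpleIntegral_eq_sum (μ : FiniteConeMeasure X E) (φ : SimpleFunc X ℝ≥0) {ι : Type*}
    (s : Finset ι) {S : ι → Set X} (hS : ∀ i, MeasurableSet (S i))
    (hd : ∀ i ∈ s, ∀ j ∈ s, i ≠ j → Disjoint (S i) (S j)) (c : ι → ℝ≥0)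
    (h1 : ∀ i ∈ s, ∀ x ∈ S i, φ x = c i) (h2 : ∀ x, φ x ≠ 0 → ∃ i ∈ s, x ∈ S i) :
    μ.simpleIntegral φ = ∑ i ∈ s, (c i : ℝ) • μ (S i) := by
  have e1 : ∀ r ∈ φ.range, (r : ℝ) • μ (φ ⁻¹' {r}) =
      ∑ i ∈ s, (r : ℝ) • μ (S i ∩ φ ⁻¹' {r}) := by
    intro r _
    rcases eq_or_ne r 0 with rfl | hr
    · simp
    rw [← Finset.smul_sum, ← μ.sum_inter s hS hd (φ.measurableSet_fiber r)]
    intro x hx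
    obtain ⟨i, hi, hxi⟩ := h2 x (by rw [show φ x = r from hx]; exact hr)
    exact mem_iUnion₂.2 ⟨i, hi, hxi⟩
  have e2 : ∀ i ∈ s, (c i : ℝ) • μ (S i) = ∑ r ∈ φ.range, (r : ℝ) • μ (S i ∩ φ ⁻¹' {r}) := by
    intro i hi
    rw [μ.sum_inter φ.range (S := fun r => φ ⁻¹' {r}) (fun r => φ.measurableSet_fiber r)
      (fun a _ b _ hab => (disjoint_singleton.2 hab).preimage φ) (hS i)
      (fun x _ => mem_iUnion₂.2 ⟨φ x, SimpleFunc.mem_range_self φ x, rfl⟩), Finset.smul_sum]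
    refine Finset.sum_congr rfl fun r _ => ?_
    rw [inter_comm]
    rcases (S i ∩ φ ⁻¹' {r}).eq_empty_or_nonempty with h | ⟨x, hx, hxr⟩
    · rw [h, μ.empty, smul_zero, smul_zero]
    · rw [← h1 i hi x hx, show φ x = r from hxr]
  rw [simpleIntegral, Finset.sum_congr rfl e1, Finset.sum_comm, Finset.sum_congr rfl e2]

theorem simpleIntegral_of_pair (μ : FiniteConeMeasure X E) (φ ψ χ : SimpleFunc X ℝ≥0)
    (g : ℝ≥0 × ℝ≥0 → ℝ≥0) (h : ∀ x, χ x = g (φ x, ψ x)) :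
    μ.simpleIntegral χ =
      ∑ p ∈ (φ.pair ψ).range, (g p : ℝ) • μ (φ.pair ψ ⁻¹' {p}) := by
  refine μ.simpleIntegral_eq_sum χ _ (fun p => SimpleFunc.measurableSet_fiber _ p)
    (fun a _ b _ hab => (disjoint_singleton.2 hab).preimage _) g ?_ ?_
  · rintro p - x rfl
    rw [h, SimpleFunc.pair_apply]
  · exact fun x _ => ⟨_, SimpleFunc.mem_range_self _ x, rfl⟩

theorem simpleIntegral_nonneg (μ : FiniteConeMeasure X E) (φ : SimpleFunc X ℝ≥0) :
    0 ≤ μ.simpleIntegral φ :=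
  Finset.sum_nonneg fun r _ => smul_nonneg r.2 (μ.nonneg _ (φ.measurableSet_fiber r))

theorem simpleIntegral_add (μ : FiniteConeMeasure X E) (φ ψ : SimpleFunc X ℝ≥0) :
    μ.simpleIntegral (φ + ψ) = μ.simpleIntegral φ + μ.simpleIntegral ψ := by
  rw [μ.simpleIntegral_of_pair φ ψ (φ + ψ) (fun p => p.1 + p.2) (fun _ => rfl),
    μ.simpleIntegral_of_pair φ ψ φ (fun p => p.1) (fun _ => rfl),
    μ.simpleIntegral_of_pair φ ψ ψ (fun p => p.2) (fun _ => rfl), ← Finset.sum_add_distrib]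
  simp only [NNReal.coe_add, add_smul]

theorem simpleIntegral_mono (μ : FiniteConeMeasure X E) {φ ψ : SimpleFunc X ℝ≥0} (h : φ ≤ ψ) :
    μ.simpleIntegral φ ≤ μ.simpleIntegral ψ := by
  rw [μ.simpleIntegral_of_pair φ ψ φ (fun p => p.1) (fun _ => rfl),
    μ.simpleIntegral_of_pair φ ψ ψ (fun p => p.2) (fun _ => rfl)]
  refine Finset.sum_le_sum fun p hp => ?_
  obtain ⟨x, rfl⟩ := SimpleFunc.mem_range.1 hp
  exact smul_le_smul_of_nonneg_right (NNReal.coe_le_coe.2 (h x))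
    (μ.nonneg _ (SimpleFunc.measurableSet_fiber _ _))

theorem simpleIntegral_smul (μ : FiniteConeMeasure X E) (c : ℝ≥0) (φ : SimpleFunc X ℝ≥0) :
    μ.simpleIntegral (c • φ) = (c : ℝ) • μ.simpleIntegral φ := by
  rw [μ.simpleIntegral_of_pair φ φ (c • φ) (fun p => c * p.1) (fun _ => rfl),
    μ.simpleIntegral_of_pair φ φ φ (fun p => p.1) (fun _ => rfl), Finset.smul_sum]
  simp only [NNReal.coe_mul, mul_smul]

theorem Approximates.le {φ : ℕ → SimpleFunc X ℝ≥0} {f : X → ℝ} (h : Approximates φ f) (n : ℕ)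
    (x : X) : (φ n x : ℝ) ≤ f x :=
  Monotone.ge_of_tendsto (fun _ _ hmn => NNReal.coe_le_coe.2 (h.1 hmn x)) (h.2 x) n

theorem exists_approximates {f : X → ℝ} (hf : Measurable f) (h0 : ∀ x, 0 ≤ f x) :
    ∃ φ : ℕ → SimpleFunc X ℝ≥0, Approximates φ f := by
  have hm : Measurable fun x => ENNReal.ofReal (f x) := hf.ennreal_ofReal
  refine ⟨fun n => (SimpleFunc.eapprox (fun x => ENNReal.ofReal (f x)) n).map ENNReal.toNNReal,
    fun m n hmn x => ?_, fun x => ?_⟩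
  · exact ENNReal.toNNReal_mono (SimpleFunc.eapprox_lt_top _ n x).ne
      (SimpleFunc.monotone_eapprox _ hmn x)
  · have := (ENNReal.tendsto_toReal (ENNReal.ofReal_ne_top (r := f x))).comp
      (SimpleFunc.tendsto_eapprox hm x)
    rw [ENNReal.toReal_ofReal (h0 x)] at this
    exact this

/-- If an elementary function is dominated by the limit of an increasing sequence of elementary
functions, then its integral is dominated by the supremum of their integrals. -/
theorem simpleIntegral_le (μ : FiniteConeMeasure X E) {φ : SimpleFunc X ℝ≥0}
    {ψ : ℕ → SimpleFunc X ℝ≥0} {h : X → ℝ} (hψ : Approximates ψ h) (hφ : ∀ x, (φ x : ℝ) ≤ h x)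
    {a : E} (ha : ∀ n, μ.simpleIntegral (ψ n) ≤ a) : μ.simpleIntegral φ ≤ a := by
  refine le_of_forall_smul_le (μ.simpleIntegral_nonneg φ) fun c hc0 hc1 => ?_
  lift c to ℝ≥0 using hc0.le
  let B : ℕ → Set X := fun n => {x | c * φ x ≤ ψ n x}
  have hB : ∀ n, MeasurableSet (B n) := fun n =>
    measurableSet_le (φ.measurable.const_mul c) (ψ n).measurable
  have hm : Monotone B := fun m n hmn x hx => le_trans (show c * φ x ≤ ψ m x from hx) (hψ.1 hmn x)
  have hU : ⋃ n, B n = univ := by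
    refine eq_univ_of_forall fun x => mem_iUnion.2 ?_
    rcases eq_or_ne (φ x) 0 with h0 | h0
    · exact ⟨0, by simp [B, h0]⟩
    have h1 : ((c * φ x : ℝ≥0) : ℝ) < h x := by
      refine lt_of_lt_of_le ?_ (hφ x)
      rw [NNReal.coe_lt_coe]
      have : 0 < φ x := pos_iff_ne_zero.2 h0
      have hc1' : c < 1 := by exact_mod_cast hc1
      calc c * φ x < 1 * φ x := by gcongr
        _ = φ x := one_mul _
    obtain ⟨n, hn⟩ := ((hψ.2 x).eventually (lt_mem_nhds h1)).exists
    exact ⟨n, NNReal.coe_le_coe.1 hn.le⟩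
  have hmono : ∀ r : ℝ≥0, Monotone fun n => ((c * r : ℝ≥0) : ℝ) • μ (φ ⁻¹' {r} ∩ B n) :=
    fun r m n hmn => smul_le_smul_of_nonneg_left
      (μ.mono ((φ.measurableSet_fiber r).inter (hB m)) ((φ.measurableSet_fiber r).inter (hB n))
        (inter_subset_inter_right _ (hm hmn))) (c * r).2
  have hlub := isLUB_sum φ.range hmono fun r => isLUB_smul (c * r).2
    (μ.isLUB_inter hB hm hU (φ.measurableSet_fiber r))
  have e : (c : ℝ) • μ.simpleIntegral φ =
      ∑ r ∈ φ.range, ((c * r : ℝ≥0) : ℝ) • μ (φ ⁻¹' {r}) := by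
    simp only [simpleIntegral, Finset.smul_sum, NNReal.coe_mul, mul_smul]
  rw [e]
  refine hlub.2 ?_
  rintro _ ⟨n, rfl⟩
  let χ : SimpleFunc X ℝ≥0 := SimpleFunc.piecewise (B n) (hB n) (c • φ) 0
  have hχ : μ.simpleIntegral χ = ∑ r ∈ φ.range, ((c * r : ℝ≥0) : ℝ) • μ (φ ⁻¹' {r} ∩ B n) := by
    classical
    refine μ.simpleIntegral_eq_sum χ φ.range (S := fun r => φ ⁻¹' {r} ∩ B n)
      (fun r => (φ.measurableSet_fiber r).inter (hB n))
      (fun a _ b _ hab => ((disjoint_singleton.2 hab).preimage φ).mono inter_subset_left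
        inter_subset_left) (fun r => c * r) ?_ ?_
    · rintro r - x ⟨hx, hxB⟩
      rw [← show φ x = r from hx]
      simp [χ, SimpleFunc.piecewise_apply, hxB]
    · intro x hx
      refine ⟨φ x, SimpleFunc.mem_range_self φ x, rfl, ?_⟩
      by_contra hxB
      simp [χ, SimpleFunc.piecewise_apply, hxB] at hx
  have hle : χ ≤ ψ n := by
    classical
    intro x
    by_cases hxB : x ∈ B n
    · have hx : c * φ x ≤ ψ n x := hxB
      simpa [χ, SimpleFunc.piecewise_apply, hxB] using hx
    · simp [χ, SimpleFunc.piecewise_apply, hxB]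
  exact (hχ.symm.le.trans (μ.simpleIntegral_mono hle)).trans (ha n)

theorem HasPosIntegral.mono {μ : FiniteConeMeasure X E} {f g : X → ℝ} {a b : E}
    (hf : μ.HasPosIntegral f a) (hg : μ.HasPosIntegral g b) (h : ∀ x, f x ≤ g x) : a ≤ b := by
  obtain ⟨φ, hφ, ha⟩ := hf
  obtain ⟨ψ, hψ, hb⟩ := hg
  refine ha.2 ?_
  rintro _ ⟨n, rfl⟩
  exact μ.simpleIntegral_le hψ (fun x => (hφ.le n x).trans (h x)) fun m => hb.1 ⟨m, rfl⟩

theorem HasPosIntegral.unique {μ : FiniteConeMeasure X E} {f : X → ℝ} {a b : E}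
    (ha : μ.HasPosIntegral f a) (hb : μ.HasPosIntegral f b) : a = b :=
  (ha.mono hb fun _ => le_rfl).antisymm (hb.mono ha fun _ => le_rfl)

theorem HasPosIntegral.add {μ : FiniteConeMeasure X E} {f g : X → ℝ} {a b : E}
    (hf : μ.HasPosIntegral f a) (hg : μ.HasPosIntegral g b) :
    μ.HasPosIntegral (fun x => f x + g x) (a + b) := by
  obtain ⟨φ, hφ, ha⟩ := hf
  obtain ⟨ψ, hψ, hb⟩ := hg
  refine ⟨fun n => φ n + ψ n, ⟨fun m n h => add_le_add (hφ.1 h) (hψ.1 h), fun x => ?_⟩, ?_⟩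
  · simpa using (hφ.2 x).add (hψ.2 x)
  · simp only [simpleIntegral_add]
    exact isLUB_add (fun m n h => μ.simpleIntegral_mono (hφ.1 h))
      (fun m n h => μ.simpleIntegral_mono (hψ.1 h)) ha hb

theorem HasPosIntegral.smul {μ : FiniteConeMeasure X E} {f : X → ℝ} {a : E} {c : ℝ} (hc : 0 ≤ c)
    (hf : μ.HasPosIntegral f a) : μ.HasPosIntegral (fun x => c * f x) (c • a) := by
  lift c to ℝ≥0 using hc
  obtain ⟨φ, hφ, ha⟩ := hf
  refine ⟨fun n => c • φ n, ⟨fun m n h x => ?_, fun x => ?_⟩, ?_⟩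
  · exact mul_le_mul_right (hφ.1 h x) c
  · simpa using (hφ.2 x).const_mul (c : ℝ)
  · simp only [simpleIntegral_smul]
    exact isLUB_smul c.2 ha

/-- A measurable function that vanishes outside a set of measure zero has integral zero. -/
theorem hasPosIntegral_zero {μ : FiniteConeMeasure X E} {f : X → ℝ} (hf : Measurable f)
    (h0 : ∀ x, 0 ≤ f x) (h : μ {x | f x ≠ 0} = 0) : μ.HasPosIntegral f 0 := by
  obtain ⟨φ, hφ⟩ := exists_approximates hf h0
  refine ⟨φ, hφ, ?_⟩
  have hz : ∀ n, μ.simpleIntegral (φ n) = 0 := by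
    intro n
    refine Finset.sum_eq_zero fun r _ => ?_
    rcases eq_or_ne r 0 with rfl | hr
    · simp
    have hm : MeasurableSet {x | f x ≠ 0} := (hf (measurableSet_singleton 0)).compl
    have : μ (φ n ⁻¹' {r}) ≤ 0 := h ▸ μ.mono ((φ n).measurableSet_fiber r) hm (by
      intro x hx hfx
      have h1 := hφ.le n x
      rw [hfx, show φ n x = r from hx] at h1
      exact hr (le_antisymm (by exact_mod_cast h1) zero_le))
    rw [le_antisymm this (μ.nonneg _ ((φ n).measurableSet_fiber r)), smul_zero]
  simp [hz]

/-- The order integral of a function `f ≥ 0` with finite integral. -/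
def posIntegral (μ : FiniteConeMeasure X E) (f : X → ℝ) : E :=
  open Classical in if h : ∃ a, μ.HasPosIntegral f a then h.choose else 0

theorem HasPosIntegral.eq {μ : FiniteConeMeasure X E} {f : X → ℝ} {a : E}
    (h : μ.HasPosIntegral f a) : μ.posIntegral f = a := by
  have h' : ∃ a, μ.HasPosIntegral f a := ⟨a, h⟩
  rw [posIntegral, dif_pos h']
  exact h'.choose_spec.unique h

section Complete

variable [SigmaMonotoneComplete E]

theorem exists_hasPosIntegral_of_le {μ : FiniteConeMeasure X E} {f g : X → ℝ} (hf : Measurable f)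
    (h0 : ∀ x, 0 ≤ f x) (h : ∀ x, f x ≤ g x) (hg : ∃ b, μ.HasPosIntegral g b) :
    ∃ a, μ.HasPosIntegral f a := by
  obtain ⟨φ, hφ⟩ := exists_approximates hf h0
  obtain ⟨b, ψ, hψ, hb⟩ := hg
  obtain ⟨a, ha⟩ := SigmaMonotoneComplete.exists_isLUB (fun n => μ.simpleIntegral (φ n))
    (fun m n hmn => μ.simpleIntegral_mono (hφ.1 hmn)) ⟨b, by
      rintro _ ⟨n, rfl⟩
      exact μ.simpleIntegral_le hψ (fun x => (hφ.le n x).trans (h x)) fun m => hb.1 ⟨m, rfl⟩⟩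
  exact ⟨a, φ, hφ, ha⟩

/-! ### Integrable functions and the order integral -/

/-- The space `𝓛¹` of measurable functions `f : X → ℝ` such that the order integral of `|f|` is
finite. It carries the pointwise ordering. -/
def L1 (μ : FiniteConeMeasure X E) : Submodule ℝ (X → ℝ) where
  carrier := {f | Measurable f ∧ ∃ a, μ.HasPosIntegral (fun x => |f x|) a}
  zero_mem' := ⟨measurable_const, 0, hasPosIntegral_zero (by simp) (by simp) (by simp [μ.empty])⟩
  add_mem' := by
    rintro f g ⟨hf, a, ha⟩ ⟨hg, b, hb⟩
    exact ⟨hf.add hg, exists_hasPosIntegral_of_le (hf.add hg).abs (fun x => abs_nonneg _)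
      (fun x => abs_add_le (f x) (g x)) ⟨_, ha.add hb⟩⟩
  smul_mem' := by
    rintro c f ⟨hf, a, ha⟩
    refine ⟨hf.const_smul c, |c| • a, ?_⟩
    simpa [abs_mul] using ha.smul (abs_nonneg c)

theorem hasPosIntegral_pos {μ : FiniteConeMeasure X E} {f : X → ℝ} (hf : f ∈ μ.L1) :
    μ.HasPosIntegral (fun x => max (f x) 0) (μ.posIntegral fun x => max (f x) 0) := by
  obtain ⟨a, ha⟩ := exists_hasPosIntegral_of_le (hf.1.max measurable_const)
    (fun x => le_max_right _ _) (fun x => max_le (le_abs_self _) (abs_nonneg _)) hf.2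
  rwa [ha.eq]

/-- The order integral of `f ∈ 𝓛¹`: the difference of the integrals of the positive and negative
parts of `f`. -/
def integralFun (μ : FiniteConeMeasure X E) (f : X → ℝ) : E :=
  μ.posIntegral (fun x => max (f x) 0) - μ.posIntegral (fun x => max (-f x) 0)

theorem integralFun_eq {μ : FiniteConeMeasure X E} {f g h : X → ℝ} (hf : f ∈ μ.L1) {a b : E}
    (hg : μ.HasPosIntegral g a) (hh : μ.HasPosIntegral h b) (e : ∀ x, f x = g x - h x) :
    μ.integralFun f = a - b := by
  have h1 := (hasPosIntegral_pos hf).add hh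
  have h2 := (hasPosIntegral_pos (neg_mem hf)).add hg
  have : (fun x => max (f x) 0 + h x) = fun x => max ((-f) x) 0 + g x := by
    funext x
    have := max_zero_sub_eq_self (f x)
    simp only [Pi.neg_apply]
    linarith [e x]
  rw [this] at h1
  have := h1.unique h2
  rw [integralFun, sub_eq_sub_iff_add_eq_add, this, add_comm]
  rfl

/-- The order integral operator `I_μ : 𝓛¹ → E`. -/
def integral (μ : FiniteConeMeasure X E) : μ.L1 →ₗ[ℝ] E where
  toFun f := μ.integralFun f
  map_add' f g := by
    have hf := hasPosIntegral_pos f.2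
    have hf' := hasPosIntegral_pos (neg_mem f.2)
    have hg := hasPosIntegral_pos g.2
    have hg' := hasPosIntegral_pos (neg_mem g.2)
    rw [integralFun_eq (f + g).2 (hf.add hg) (hf'.add hg') fun x => ?_]
    · simp only [integralFun, Pi.neg_apply]
      abel
    · have h1 := max_zero_sub_eq_self ((f : X → ℝ) x)
      have h2 := max_zero_sub_eq_self ((g : X → ℝ) x)
      simp only [Pi.neg_apply, Submodule.coe_add, Pi.add_apply]
      linarith
  map_smul' c f := by
    have hf := hasPosIntegral_pos f.2
    have hf' := hasPosIntegral_pos (neg_mem f.2)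
    have h1 : ∀ x, (f : X → ℝ) x = max ((f : X → ℝ) x) 0 - max (-(f : X → ℝ) x) 0 := fun x =>
      (max_zero_sub_eq_self _).symm
    rcases le_total 0 c with hc | hc
    · rw [integralFun_eq (c • f).2 (hf.smul hc) (hf'.smul hc) fun x => ?_]
      · simp only [integralFun, Pi.neg_apply, RingHom.id_apply, smul_sub]
      · simp only [Pi.neg_apply, Submodule.coe_smul, Pi.smul_apply, smul_eq_mul]
        rw [← mul_sub, ← h1]
    · rw [integralFun_eq (c • f).2 (hf'.smul (neg_nonneg.2 hc)) (hf.smul (neg_nonneg.2 hc))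
        fun x => ?_]
      · simp only [integralFun, Pi.neg_apply, RingHom.id_apply, smul_sub, neg_smul]
        abel
      · simp only [Pi.neg_apply, Submodule.coe_smul, Pi.smul_apply, smul_eq_mul]
        rw [← mul_sub]
        nth_rw 1 [h1 x]
        ring

/-- The subspace `𝓝` of `𝓛¹` of the functions that vanish almost everywhere. -/
def null (μ : FiniteConeMeasure X E) : Submodule ℝ μ.L1 where
  carrier := {f | μ {x | (f : X → ℝ) x ≠ 0} = 0}
  zero_mem' := by simp [μ.empty]
  add_mem' := by
    intro f g hf hg
    have hm : ∀ h : μ.L1, MeasurableSet {x | (h : X → ℝ) x ≠ 0} := fun h =>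
      (h.2.1 (measurableSet_singleton 0)).compl
    have h1 : μ ({x | (f : X → ℝ) x ≠ 0} ∪ {x | (g : X → ℝ) x ≠ 0}) = 0 := by
      have := μ.union (hm f) ((hm g).diff (hm f)) disjoint_sdiff_right
      rw [union_sdiff_self, show μ {x | (f : X → ℝ) x ≠ 0} = 0 from hf, zero_add] at this
      rw [this]
      exact le_antisymm ((μ.mono ((hm g).diff (hm f)) (hm g) sdiff_subset).trans
        (le_of_eq hg)) (μ.nonneg _ ((hm g).diff (hm f)))
    refine le_antisymm ((μ.mono (hm (f + g)) ((hm f).union (hm g)) ?_).trans h1.le)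
      (μ.nonneg _ (hm (f + g)))
    intro x hx
    by_contra hn
    simp only [mem_union, mem_ofPred_eq, not_or, not_not] at hn
    exact hx (by simp [hn.1, hn.2])
  smul_mem' := by
    intro c f hf
    have hm : ∀ h : μ.L1, MeasurableSet {x | (h : X → ℝ) x ≠ 0} := fun h =>
      (h.2.1 (measurableSet_singleton 0)).compl
    refine le_antisymm ((μ.mono (hm (c • f)) (hm f) ?_).trans (le_of_eq hf))
      (μ.nonneg _ (hm (c • f)))
    intro x hx hfx
    exact hx (by simp [hfx])

theorem null_le_ker (μ : FiniteConeMeasure X E) : μ.null ≤ LinearMap.ker μ.integral := by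
  intro f hf
  have hm : MeasurableSet {x | (f : X → ℝ) x ≠ 0} := (f.2.1 (measurableSet_singleton 0)).compl
  have key : ∀ g : X → ℝ, Measurable g → (∀ x, (f : X → ℝ) x = 0 → g x ≤ 0) →
      μ.HasPosIntegral (fun x => max (g x) 0) 0 := by
    intro g hg h
    have hgm : Measurable fun x => max (g x) 0 := hg.max measurable_const
    refine hasPosIntegral_zero hgm (fun x => le_max_right _ _) ?_
    have hm' : MeasurableSet {x | max (g x) 0 ≠ 0} := (hgm (measurableSet_singleton 0)).compl
    refine le_antisymm ((μ.mono hm' hm ?_).trans (le_of_eq hf)) (μ.nonneg _ hm')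
    intro x hx hfx
    exact hx (max_eq_right (h x hfx))
  have h1 := (key f f.2.1 fun x hx => hx.le).eq
  have h2 := (key (fun x => -(f : X → ℝ) x) f.2.1.neg fun x hx => by simp [hx]).eq
  change μ.integralFun f = 0
  rw [integralFun, h1, h2, sub_zero]

/-- The space `L¹ = 𝓛¹ / 𝓝`. -/
def L1Quot (μ : FiniteConeMeasure X E) : Type _ := μ.L1 ⧸ μ.null

instance (μ : FiniteConeMeasure X E) : AddCommGroup μ.L1Quot :=
  inferInstanceAs (AddCommGroup (μ.L1 ⧸ μ.null))

instance (μ : FiniteConeMeasure X E) : Module ℝ μ.L1Quot :=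
  inferInstanceAs (Module ℝ (μ.L1 ⧸ μ.null))

/-- The quotient map `𝓛¹ → L¹`. -/
def toQuot (μ : FiniteConeMeasure X E) : μ.L1 →ₗ[ℝ] μ.L1Quot := μ.null.mkQ

/-- The quotient ordering on `L¹`: the positive cone is the image of the positive cone of `𝓛¹`. -/
instance (μ : FiniteConeMeasure X E) : PartialOrder μ.L1Quot where
  le u v := ∃ f g : μ.L1, f ≤ g ∧ μ.toQuot f = u ∧ μ.toQuot g = v
  le_refl u := by
    obtain ⟨f, rfl⟩ := μ.null.mkQ_surjective u
    exact ⟨f, f, le_rfl, rfl, rfl⟩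
  le_trans := by
    rintro _ _ _ ⟨f, g, hfg, rfl, rfl⟩ ⟨g', h, hgh, e, rfl⟩
    refine ⟨f + (g' - g), h, fun x => ?_, by simp [e], rfl⟩
    have h1 : (f : X → ℝ) x ≤ (g : X → ℝ) x := hfg x
    have h2 : (g' : X → ℝ) x ≤ (h : X → ℝ) x := hgh x
    change (f : X → ℝ) x + ((g' : X → ℝ) x - (g : X → ℝ) x) ≤ (h : X → ℝ) x
    linarith
  le_antisymm := by
    rintro _ _ ⟨f, g, hfg, rfl, rfl⟩ ⟨g', f', hgf, e1, e2⟩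
    have hm : ∀ h : μ.L1, MeasurableSet {x | (h : X → ℝ) x ≠ 0} := fun h =>
      (h.2.1 (measurableSet_singleton 0)).compl
    have n1 : (f' - f) + (g - g') ∈ μ.null :=
      add_mem ((Submodule.Quotient.eq _).1 e2) ((Submodule.Quotient.eq _).1 e1.symm)
    refine (Submodule.Quotient.eq _).2 (le_antisymm ((μ.mono (hm (f - g))
      (hm ((f' - f) + (g - g'))) ?_).trans (le_of_eq n1)) (μ.nonneg _ (hm (f - g))))
    intro x hx h0
    have h1 : (f : X → ℝ) x ≤ (g : X → ℝ) x := hfg x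
    have h2 : (g' : X → ℝ) x ≤ (f' : X → ℝ) x := hgf x
    have h3 : ((f' : X → ℝ) x - (f : X → ℝ) x) + ((g : X → ℝ) x - (g' : X → ℝ) x) = 0 := h0
    refine hx ?_
    change (f : X → ℝ) x - (g : X → ℝ) x = 0
    linarith

/-- The operator `I_μ : L¹ → E` induced by the order integral. -/
def integralQuot (μ : FiniteConeMeasure X E) : μ.L1Quot →ₗ[ℝ] E :=
  μ.null.liftQ μ.integral μ.null_le_ker

end Complete

end FiniteConeMeasure

end OrderInt

end

/-! Spectrality makes the integral multiplicative (`integral_mul`), and multiplicativity makes it a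
lattice homomorphism. With `S = {g ≤ f}` one has `f ∨ g = χ_S f + χ_{Sᶜ} g`, so `I(f ∨ g) = μ(S)
I(f) + μ(Sᶜ) I(g)`. If `I(f), I(g) ≤ b` and `b = μ(X) b`, multiplying by the positive elements
`μ(S)`, `μ(Sᶜ)` and adding gives `I(f ∨ g) ≤ μ(X) b = b` (`integral_sup_le_of_mul_left`, with a
mirror image on the right).

Elements of the image of `I` are such bounds `b`, so `I(f) ≤ I(g)` forces `I(f ∨ g) = I(g)`. Hence
`I(f) = 0` gives `I(|f|) = 0`, and then `f = 0` almost everywhere by Chebyshev's inequality;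
moreover, `L¹ → A` is an order embedding (`integralQuot_le_iff`). Monotone convergence shows that
the supremum in `A` of the image of a bounded increasing sequence in `L¹` lies in the image again
(`sigmaClosedRange_integralQuot`).

Completeness and order continuity then follow formally for any such embedding of a space with binary
suprema. For nets, monotone completeness and the countable sup property of `A` reduce a directed set
to an increasing sequence inside it (`exists_isLUB_image_of_directed`). The algebraic structure
passes from `𝓛¹` to the image by surjectivity, and from the image to `L¹` by the order isomorphism.
-/

namespace OrderInt

/-! ### Order embeddings with sequentially closed range -/

section OrderEmbedding

variable {E A : Type*} [AddCommGroup E] [Module ℝ E] [PartialOrder E]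
  [AddCommGroup A] [Module ℝ A] [PartialOrder A] {T : E →ₗ[ℝ] A}

theorem isLUB_of_isLUB_image (hT : ∀ u v, T u ≤ T v ↔ u ≤ v) {D : Set E} {w : E}
    (h : IsLUB (T '' D) (T w)) : IsLUB D w :=
  ⟨fun d hd => (hT _ _).1 (h.1 ⟨d, hd, rfl⟩), fun c hc => (hT _ _).1 (h.2 (by
    rintro _ ⟨d, hd, rfl⟩
    exact (hT _ _).2 (hc hd)))⟩

/-- The supremum in `A` of the image of a bounded increasing sequence is in the image of `T`. -/
def SigmaClosedRange (T : E →ₗ[ℝ] A) : Prop :=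
  ∀ u : ℕ → E, Monotone u → BddAbove (range u) → ∃ w, IsLUB (T '' range u) (T w)

/-- The lattice structure of a partially ordered set in which pairs have suprema. -/
@[reducible] noncomputable def semilatticeSupOfExists (h : ∀ x y : E, ∃ z, IsLUB {x, y} z) :
    SemilatticeSup E where
  sup x y := (h x y).choose
  le_sup_left x y := (h x y).choose_spec.1 (by simp)
  le_sup_right x y := (h x y).choose_spec.1 (by simp)
  sup_le x y z hx hy := (h x y).choose_spec.2 (by simp [hx, hy])

/-- The partial suprema of an enumeration form an increasing sequence with the same upper bounds as
the countable set. -/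
theorem sigmaDedekindComplete_of_embedding (hT : ∀ u v, T u ≤ T v ↔ u ≤ v)
    (hE : ∀ x y : E, ∃ z, IsLUB {x, y} z) (hσ : SigmaClosedRange T) :
    SigmaDedekindComplete E := by
  intro S hS hSc hSb
  let _ := semilatticeSupOfExists hE
  obtain ⟨f, rfl⟩ := hSc.exists_eq_range hS
  obtain ⟨w, hw⟩ := hσ (partialSups f) (partialSups f).monotone
    (by rwa [bddAbove_range_partialSups])
  have := isLUB_of_isLUB_image hT hw
  refine ⟨w, ?_⟩
  rwa [IsLUB, upperBounds_range_partialSups] at this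

theorem isPositiveSigmaOrderContinuous_of_embedding [IsOrderedAddMonoid E] [IsOrderedAddMonoid A]
    (hT : ∀ u v, T u ≤ T v ↔ u ≤ v) (hσ : SigmaClosedRange T) :
    IsPositiveSigmaOrderContinuous T := by
  refine ⟨fun x hx => by simpa using (hT 0 x).2 hx, fun x hx h => ?_⟩
  have hneg : -range x = range fun n => -x n := by
    ext y
    simp [eq_neg_iff_add_eq_zero, neg_eq_iff_add_eq_zero, add_comm]
  have h0 := isLUB_neg'.2 h
  rw [hneg] at h0
  obtain ⟨w, hw⟩ := hσ (fun n => -x n) (fun m n hmn => neg_le_neg (hx hmn)) ⟨_, h0.1⟩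
  rw [(isLUB_of_isLUB_image hT hw).unique h0, ← range_comp] at hw
  refine isLUB_neg'.1 ?_
  convert hw using 1
  · ext y
    simp [eq_neg_iff_add_eq_zero, neg_eq_iff_add_eq_zero, add_comm]
  · simp

/-- All statements on nets come down to this one: an increasing sequence inside `D` already attains
the supremum of the image. The countable set `C` is kept for the countable sup property. -/
theorem exists_isLUB_image_of_directed [IsOrderedAddMonoid E] [IsOrderedAddMonoid A]
    (hT : ∀ u v, T u ≤ T v ↔ u ≤ v) (hσ : SigmaClosedRange T)
    (hm : MonotoneComplete A) (hc : CountableSupProperty A) {D : Set E} (hD : D.Nonempty)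
    (hd : DirectedOn (· ≤ ·) D) (hb : BddAbove D) :
    ∃ w, IsLUB (T '' D) (T w) ∧ ∃ C ⊆ D, C.Nonempty ∧ C.Countable ∧ IsLUB (T '' C) (T w) := by
  obtain ⟨d₀, hd₀⟩ := hD
  obtain ⟨v, hv⟩ := hb
  -- The countable sup property concerns positive elements only, so `D` is cut down to its tail
  -- above `d₀` and the image is translated by `T d₀`.
  set D₀ : Set E := {d ∈ D | d₀ ≤ d} with hD₀
  set F : Set A := (fun d => T d - T d₀) '' D₀ with hF
  have hFd : DirectedOn (· ≤ ·) F := by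
    rintro _ ⟨x, hx, rfl⟩ _ ⟨y, hy, rfl⟩
    obtain ⟨z, hz, hxz, hyz⟩ := hd x hx.1 y hy.1
    exact ⟨_, ⟨z, ⟨hz, hx.2.trans hxz⟩, rfl⟩, sub_le_sub_right ((hT _ _).2 hxz) _,
      sub_le_sub_right ((hT _ _).2 hyz) _⟩
  have hFn : F.Nonempty := ⟨_, d₀, ⟨hd₀, le_rfl⟩, rfl⟩
  obtain ⟨a, ha⟩ := hm F hFn hFd ⟨T v - T d₀, by
    rintro _ ⟨x, hx, rfl⟩
    exact sub_le_sub_right ((hT _ _).2 (hv hx.1)) _⟩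
  obtain ⟨G, hGF, hGn, hGc, hG⟩ := hc F a hFn hFd (by
    rintro _ ⟨x, hx, rfl⟩
    exact sub_nonneg.2 ((hT _ _).2 hx.2)) ha
  obtain ⟨g, rfl⟩ := hGc.exists_eq_range hGn
  choose p hp hpg using fun n => hGF ⟨n, rfl⟩
  have hdir : ∀ x : D, ∀ y : D, ∃ z : D, x ≤ z ∧ y ≤ z := fun x y => by
    obtain ⟨z, hz, hxz, hyz⟩ := hd x x.2 y y.2
    exact ⟨⟨z, hz⟩, hxz, hyz⟩
  choose J hJ₁ hJ₂ using hdir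
  -- The countably many `p n` need not increase; directedness yields an increasing sequence `q` in
  -- `D` with `p n ≤ q n`.
  let q : ℕ → D := fun n => Nat.rec ⟨p 0, (hp 0).1⟩ (fun k z => J z ⟨p (k + 1), (hp (k + 1)).1⟩) n
  have hq : Monotone q := monotone_nat_of_le_succ fun n => hJ₁ _ _
  have hpq : ∀ n, p n ≤ (q n).1 := by
    rintro (_ | n)
    · exact le_rfl
    · exact hJ₂ _ ⟨p (n + 1), (hp (n + 1)).1⟩
  have hu : Monotone fun n => (q n).1 := fun m n h => hq h
  obtain ⟨w, hw⟩ := hσ _ hu ⟨v, by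
    rintro _ ⟨n, rfl⟩
    exact hv (q n).2⟩
  have hDle : ∀ d ∈ D, T d ≤ T w := by
    intro d hdD
    obtain ⟨z, hz, hdz, hz₀⟩ := hd d hdD d₀ hd₀
    -- `T w` dominates each `T (p n)`, and the `T (p n) - T d₀` have supremum `a`; since the tail
    -- `D₀` is cofinal in `D`, `T w` dominates all of `T '' D`.
    have h1 : a ≤ T w - T d₀ := hG.2 (by
      rintro _ ⟨n, rfl⟩
      rw [← hpg]
      exact sub_le_sub_right (((hT _ _).2 (hpq n)).trans (hw.1 ⟨_, ⟨n, rfl⟩, rfl⟩)) _)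
    have h2 : T z - T d₀ ≤ T w - T d₀ := (ha.1 ⟨z, ⟨hz, hz₀⟩, rfl⟩).trans h1
    exact ((hT _ _).2 hdz).trans ((sub_le_sub_iff_right _).1 h2)
  refine ⟨w, ⟨?_, fun c hc => hw.2 ?_⟩, range fun n => (q n).1, ?_, range_nonempty _,
    countable_range _, hw⟩
  · rintro _ ⟨d, hdD, rfl⟩
    exact hDle d hdD
  · rintro _ ⟨_, ⟨n, rfl⟩, rfl⟩
    exact hc ⟨_, (q n).2, rfl⟩
  · rintro _ ⟨n, rfl⟩
    exact (q n).2

/-- Closing a set under binary suprema makes it directed and does not change its upper bounds. -/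
theorem dedekindComplete_of_embedding [IsOrderedAddMonoid E] [IsOrderedAddMonoid A]
    (hT : ∀ u v, T u ≤ T v ↔ u ≤ v) (hE : ∀ x y : E, ∃ z, IsLUB {x, y} z)
    (hσ : SigmaClosedRange T) (hm : MonotoneComplete A) (hc : CountableSupProperty A) :
    DedekindComplete E := by
  intro S hS hSb
  let _ := semilatticeSupOfExists hE
  obtain ⟨w, hw, -⟩ := exists_isLUB_image_of_directed hT hσ hm hc (D := supClosure S)
    (hS.mono subset_supClosure) supClosed_supClosure.directedOn (by
      rw [BddAbove, upperBounds_supClosure]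
      exact hSb)
  exact ⟨w, isLUB_supClosure.1 (isLUB_of_isLUB_image hT hw)⟩

theorem countableSupProperty_of_embedding [IsOrderedAddMonoid E] [IsOrderedAddMonoid A]
    (hT : ∀ u v, T u ≤ T v ↔ u ≤ v) (hσ : SigmaClosedRange T) (hm : MonotoneComplete A)
    (hc : CountableSupProperty A) : CountableSupProperty E := by
  intro D x hD hd _ hx
  obtain ⟨w, hw, C, hCD, hCn, hCc, hC⟩ := exists_isLUB_image_of_directed hT hσ hm hc hD hd ⟨x, hx.1⟩
  rw [(isLUB_of_isLUB_image hT hw).unique hx] at hC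
  exact ⟨C, hCD, hCn, hCc, isLUB_of_isLUB_image hT hC⟩

theorem isPositiveOrderContinuous_of_embedding [IsOrderedAddMonoid E] [IsOrderedAddMonoid A]
    (hT : ∀ u v, T u ≤ T v ↔ u ≤ v) (hσ : SigmaClosedRange T) (hm : MonotoneComplete A)
    (hc : CountableSupProperty A) : IsPositiveOrderContinuous T := by
  refine ⟨fun x hx => by simpa using (hT 0 x).2 hx, fun D hD hd h => ?_⟩
  have h0 := isLUB_neg'.2 h
  obtain ⟨w, hw, -⟩ := exists_isLUB_image_of_directed hT hσ hm hc (D := -D) (by simpa using hD)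
    (by
      intro x hx y hy
      obtain ⟨z, hz, hxz, hyz⟩ := hd _ hx _ hy
      exact ⟨-z, by simpa using hz, le_neg_of_le_neg hxz, le_neg_of_le_neg hyz⟩) ⟨_, h0.1⟩
  rw [(isLUB_of_isLUB_image hT hw).unique h0] at hw
  refine isLUB_neg'.1 ?_
  convert hw using 1
  · ext y
    constructor
    · rintro ⟨d, hd, e⟩
      exact ⟨-d, by simpa using hd, by rw [map_neg, e, neg_neg]⟩
    · rintro ⟨d, hd, rfl⟩
      exact ⟨-d, hd, map_neg T d⟩
  · simp

end OrderEmbedding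

namespace FiniteConeMeasure

/-! ### Monotone convergence and null sets for positive integrals -/

section PartiallyOrdered

variable {X E : Type*} [MeasurableSpace X] [AddCommGroup E] [Module ℝ E] [PartialOrder E]
  {μ : FiniteConeMeasure X E}

theorem HasPosIntegral.measurable {f : X → ℝ} {a : E} (h : μ.HasPosIntegral f a) :
    Measurable f := by
  obtain ⟨φ, hφ, -⟩ := h
  exact measurable_of_tendsto_metrizable (fun n => (φ n).measurable.coe_nnreal_real)
    (tendsto_pi_nhds.2 hφ.2)

theorem HasPosIntegral.apply_nonneg {f : X → ℝ} {a : E} (h : μ.HasPosIntegral f a) (x : X) :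
    0 ≤ f x := by
  obtain ⟨φ, hφ, -⟩ := h
  exact (φ 0 x).2.trans (hφ.le 0 x)

variable [PartiallyOrderedVectorSpace E]

theorem HasPosIntegral.nonneg {f : X → ℝ} {a : E} (h : μ.HasPosIntegral f a) : 0 ≤ a := by
  obtain ⟨φ, -, ha⟩ := h
  exact (μ.simpleIntegral_nonneg (φ 0)).trans (ha.1 ⟨0, rfl⟩)

theorem measure_add_compl (μ : FiniteConeMeasure X E) {S : Set X} (hS : MeasurableSet S) :
    μ S + μ Sᶜ = μ univ := by
  rw [← μ.union hS hS.compl disjoint_compl_right, union_compl_self]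

theorem hasPosIntegral_indicator (μ : FiniteConeMeasure X E) {S : Set X} (hS : MeasurableSet S) :
    μ.HasPosIntegral (S.indicator 1) (μ S) := by
  classical
  let χ : SimpleFunc X ℝ≥0 := SimpleFunc.piecewise S hS 1 0
  have hχ : μ.simpleIntegral χ = μ S := by
    rw [μ.simpleIntegral_eq_sum χ {()} (S := fun _ => S) (fun _ => hS)
      (fun i _ j _ hij => (hij rfl).elim) (fun _ => 1) ?_ ?_]
    · simp
    · intro _ _ x hx
      simp [χ, SimpleFunc.piecewise_apply, hx]
    · intro x hx
      by_contra hn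
      have hS' : x ∉ S := fun h => hn ⟨(), Finset.mem_singleton_self _, h⟩
      simp [χ, SimpleFunc.piecewise_apply, hS'] at hx
  refine ⟨fun _ => χ, ⟨monotone_const, fun x => ?_⟩, by simp [hχ]⟩
  refine tendsto_const_nhds.congr' (Eventually.of_forall fun _ => ?_)
  by_cases hx : x ∈ S <;> simp [χ, SimpleFunc.piecewise_apply, hx]

/-- The monotone convergence theorem. -/
theorem isLUB_of_monotone {f : ℕ → X → ℝ} {g : X → ℝ} {a : ℕ → E} {b : E}
    (hf : ∀ n, μ.HasPosIntegral (f n) (a n)) (hm : Monotone f)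
    (hg : ∀ x, Tendsto (fun n => f n x) atTop (𝓝 (g x))) (hb : μ.HasPosIntegral g b) :
    IsLUB (range a) b := by
  have hfg : ∀ n x, f n x ≤ g x := fun n x =>
    Monotone.ge_of_tendsto (fun _ _ h => hm h x) (hg x) n
  refine ⟨?_, fun c hc => ?_⟩
  · rintro _ ⟨n, rfl⟩
    exact (hf n).mono hb (hfg n)
  choose φ hφ ha using hf
  obtain ⟨χ, hχ, hbχ⟩ := hb
  -- Diagonal argument: `ψ n` is the supremum of the `φ i n` with `i ≤ n`. It increases, stays below
  -- `f n`, and eventually exceeds every `φ i m`, so it approximates `g`.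
  let ψ : ℕ → SimpleFunc X ℝ≥0 := fun n => (Finset.range (n + 1)).sup fun i => φ i n
  have hφψ : ∀ i n, i ≤ n → φ i n ≤ ψ n := fun i n h =>
    Finset.le_sup (f := fun i => φ i n) (Finset.mem_range.2 (Nat.lt_succ_of_le h))
  have hψf : ∀ n x, (ψ n x : ℝ) ≤ f n x := by
    intro n x
    have h0 : 0 ≤ f n x := (φ n 0 x).2.trans ((hφ n).le 0 x)
    lift f n x to ℝ≥0 using h0 with y hy
    rw [NNReal.coe_le_coe, SimpleFunc.finset_sup_apply]
    refine Finset.sup_le fun i hi => ?_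
    rw [← NNReal.coe_le_coe, hy]
    exact ((hφ i).le n x).trans (hm (Nat.le_of_lt_succ (Finset.mem_range.1 hi)) x)
  have hψm : Monotone ψ := fun m n hmn => Finset.sup_le fun i hi =>
    ((hφ i).1 hmn).trans (hφψ i n ((Nat.le_of_lt_succ (Finset.mem_range.1 hi)).trans hmn))
  have hψ : Approximates ψ g := by
    refine ⟨hψm, fun x => tendsto_order.2 ⟨fun c hc => ?_, fun c hc => ?_⟩⟩
    · obtain ⟨n, hn⟩ := ((hg x).eventually (lt_mem_nhds hc)).exists
      obtain ⟨m, hm'⟩ := (((hφ n).2 x).eventually (lt_mem_nhds hn)).exists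
      filter_upwards [eventually_ge_atTop (max n m)] with k hk
      exact hm'.trans_le (NNReal.coe_le_coe.2 (((hφ n).1 ((le_max_right n m).trans hk) x).trans
        (hφψ n k ((le_max_left n m).trans hk) x)))
    · exact Eventually.of_forall fun n => ((hψf n x).trans (hfg n x)).trans_lt hc
  refine hbχ.2 ?_
  rintro _ ⟨k, rfl⟩
  -- Two comparisons: `χ k` lies below the limit `g` of the `ψ n`, and each `ψ n` lies below the
  -- limit `f n` of the `φ n m`, whose integrals are at most `a n ≤ c`.
  refine μ.simpleIntegral_le hψ (hχ.le k) fun n => ?_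
  exact (μ.simpleIntegral_le (hφ n) (hψf n) fun m => (ha n).1 ⟨m, rfl⟩).trans (hc ⟨n, rfl⟩)

/-- Chebyshev's inequality: where `1 ≤ n f`, the indicator is at most `n f`, whose integral is `0`;
then continuity from below. -/
theorem HasPosIntegral.measure_ne_zero {f : X → ℝ} (h : μ.HasPosIntegral f (0 : E)) :
    μ {x | f x ≠ 0} = 0 := by
  have hf := h.measurable
  have hS : MeasurableSet {x | f x ≠ 0} := (hf (measurableSet_singleton 0)).compl
  -- The zero set of `f` is included so that the `B n` exhaust `X`, as `isLUB_inter` requires.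
  let B : ℕ → Set X := fun n => {x | f x = 0 ∨ 1 ≤ n * f x}
  have hB : ∀ n, MeasurableSet (B n) := fun n => (hf (measurableSet_singleton 0)).union
    (measurableSet_le measurable_const (hf.const_mul _))
  have hBm : Monotone B := by
    rintro m n hmn x (hx | hx)
    · exact Or.inl hx
    · refine Or.inr (hx.trans (mul_le_mul_of_nonneg_right ?_ (h.apply_nonneg x)))
      exact_mod_cast hmn
  have hBU : ⋃ n, B n = univ := by
    refine eq_univ_of_forall fun x => mem_iUnion.2 ?_
    rcases (h.apply_nonneg x).eq_or_lt with h0 | h0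
    · exact ⟨0, Or.inl h0.symm⟩
    · obtain ⟨n, hn⟩ := exists_nat_ge (1 / f x)
      exact ⟨n, Or.inr ((div_le_iff₀ h0).1 hn)⟩
  have h0 : ∀ n, μ ({x | f x ≠ 0} ∩ B n) = 0 := by
    intro n
    have hm := hS.inter (hB n)
    refine le_antisymm ?_ (μ.nonneg _ hm)
    have := (μ.hasPosIntegral_indicator hm).mono (h.smul (Nat.cast_nonneg n)) fun x => by
      by_cases hx : x ∈ {x | f x ≠ 0} ∩ B n
      · rw [indicator_of_mem hx]
        exact hx.2.resolve_left hx.1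
      · rw [indicator_of_notMem hx]
        exact mul_nonneg (Nat.cast_nonneg n) (h.apply_nonneg x)
    rwa [smul_zero] at this
  have hl := μ.isLUB_inter hB hBm hBU hS
  simp only [h0, range_const] at hl
  exact hl.unique isLUB_singleton

end PartiallyOrdered

/-! ### Lattice operations and bounded monotone convergence in `𝓛¹` -/

section Complete

variable {X E : Type*} [MeasurableSpace X] [AddCommGroup E] [Module ℝ E] [PartialOrder E]
  [PartiallyOrderedVectorSpace E] [SigmaMonotoneComplete E] {μ : FiniteConeMeasure X E}

theorem HasPosIntegral.mem_L1 {f : X → ℝ} {a : E} (h : μ.HasPosIntegral f a) : f ∈ μ.L1 :=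
  ⟨h.measurable, a, by simpa only [abs_of_nonneg (h.apply_nonneg _)] using h⟩

theorem integral_eq_sub {f : μ.L1} {g h : X → ℝ} {a b : E} (hg : μ.HasPosIntegral g a)
    (hh : μ.HasPosIntegral h b) (e : ∀ x, (f : X → ℝ) x = g x - h x) : μ.integral f = a - b :=
  integralFun_eq f.2 hg hh e

theorem HasPosIntegral.integral_eq {f : μ.L1} {a : E} (h : μ.HasPosIntegral f a) :
    μ.integral f = a := by
  rw [integral_eq_sub h (hasPosIntegral_zero (f := fun _ => 0) (by simp) (by simp)
    (by simp [μ.empty])) (by simp), sub_zero]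

theorem hasPosIntegral_integral {f : μ.L1} (h : 0 ≤ f) : μ.HasPosIntegral f (μ.integral f) := by
  have h0 : ∀ x, 0 ≤ (f : X → ℝ) x := h
  have h1 := hasPosIntegral_pos f.2
  simp only [max_eq_left (h0 _)] at h1
  rwa [h1.integral_eq]

theorem integral_nonneg {f : μ.L1} (h : 0 ≤ f) : 0 ≤ μ.integral f :=
  (hasPosIntegral_integral h).nonneg

theorem integral_mono {f g : μ.L1} (h : f ≤ g) : μ.integral f ≤ μ.integral g := by
  have := integral_nonneg (μ := μ) (f := g - f) fun x => sub_nonneg.2 (h x)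
  rwa [map_sub, sub_nonneg] at this

theorem abs_mem (f : μ.L1) : (fun x => |(f : X → ℝ) x|) ∈ μ.L1 :=
  f.2.2.choose_spec.mem_L1

theorem mem_L1_of_abs_le {f g : X → ℝ} (hf : Measurable f) (hg : g ∈ μ.L1)
    (h : ∀ x, |f x| ≤ g x) : f ∈ μ.L1 := by
  have hg' := hasPosIntegral_integral (f := ⟨g, hg⟩) fun x => (abs_nonneg (f x)).trans (h x)
  exact ⟨hf, exists_hasPosIntegral_of_le hf.abs (fun _ => abs_nonneg _) h ⟨_, hg'⟩⟩

theorem sup_mem (f g : μ.L1) : (f : X → ℝ) ⊔ (g : X → ℝ) ∈ μ.L1 :=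
  mem_L1_of_abs_le (f.2.1.sup g.2.1) (add_mem (abs_mem f) (abs_mem g)) fun _ =>
    abs_max_le_max_abs_abs.trans (max_le_add_of_nonneg (abs_nonneg _) (abs_nonneg _))

theorem inf_mem (f g : μ.L1) : (f : X → ℝ) ⊓ (g : X → ℝ) ∈ μ.L1 :=
  mem_L1_of_abs_le (f.2.1.inf g.2.1) (add_mem (abs_mem f) (abs_mem g)) fun _ =>
    abs_min_le_max_abs_abs.trans (max_le_add_of_nonneg (abs_nonneg _) (abs_nonneg _))

/-- The pointwise supremum in `𝓛¹`. -/
def sup (f g : μ.L1) : μ.L1 := ⟨_, sup_mem f g⟩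

/-- The pointwise infimum in `𝓛¹`. -/
def inf (f g : μ.L1) : μ.L1 := ⟨_, inf_mem f g⟩

theorem isLUB_sup (f g : μ.L1) : IsLUB {f, g} (sup f g) := by
  refine IsLUB.of_image (f := Subtype.val) Iff.rfl ?_
  rw [image_pair]
  exact isLUB_pair

theorem isGLB_inf (f g : μ.L1) : IsGLB {f, g} (inf f g) := by
  refine IsGLB.of_image (f := Subtype.val) Iff.rfl ?_
  rw [image_pair]
  exact isGLB_pair

theorem inf_add_sup (f g : μ.L1) : inf f g + sup f g = f + g :=
  Subtype.ext (_root_.inf_add_sup (f : X → ℝ) (g : X → ℝ))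

/-- The monotone convergence theorem for sequences that are bounded in `𝓛¹`. -/
theorem exists_isLUB_integral {f : ℕ → μ.L1} {g : μ.L1} (hm : Monotone f) (hg : ∀ n, f n ≤ g) :
    ∃ h : μ.L1, IsLUB (range fun n => μ.integral (f n)) (μ.integral h) := by
  have hb : ∀ x, BddAbove (range fun n => (f n : X → ℝ) x) := fun x => ⟨(g : X → ℝ) x, by
    rintro _ ⟨n, rfl⟩
    exact hg n x⟩
  have hmx : ∀ x, Monotone fun n => (f n : X → ℝ) x := fun x _ _ h => hm h x
  let s : X → ℝ := fun x => ⨆ n, (f n : X → ℝ) x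
  have hs : ∀ x, Tendsto (fun n => (f n : X → ℝ) x) atTop (𝓝 (s x)) := fun x =>
    tendsto_atTop_ciSup (hmx x) (hb x)
  have h0s : ∀ x, (f 0 : X → ℝ) x ≤ s x := fun x => le_ciSup (hb x) 0
  have hsg : ∀ x, s x ≤ (g : X → ℝ) x := fun x => ciSup_le fun n => hg n x
  have hsm : s ∈ μ.L1 := mem_L1_of_abs_le
    (measurable_of_tendsto_metrizable (fun n => (f n).2.1) (tendsto_pi_nhds.2 hs))
    (add_mem (abs_mem (f 0)) (abs_mem g)) fun x =>
      (abs_le_max_abs_abs (h0s x) (hsg x)).trans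
        (max_le_add_of_nonneg (abs_nonneg _) (abs_nonneg _))
  let h : μ.L1 := ⟨s, hsm⟩
  refine ⟨h, ?_⟩
  -- Monotone convergence is available for positive functions, hence the subtraction of `f 0`.
  have key := isLUB_of_monotone (μ := μ) (f := fun n => ((f n - f 0 : μ.L1) : X → ℝ))
    (g := ((h - f 0 : μ.L1) : X → ℝ))
    (fun n => hasPosIntegral_integral fun x => sub_nonneg.2 (hm (Nat.zero_le n) x))
    (fun m n hmn x => sub_le_sub_right (hm hmn x) _) (fun x => (hs x).sub_const _)
    (hasPosIntegral_integral fun x => sub_nonneg.2 (h0s x))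
  simp only [map_sub] at key
  refine ⟨?_, fun c hc => ?_⟩
  · rintro _ ⟨n, rfl⟩
    exact (sub_le_sub_iff_right _).1 (key.1 ⟨n, rfl⟩)
  · refine (sub_le_sub_iff_right (μ.integral (f 0))).1 (key.2 ?_)
    rintro _ ⟨n, rfl⟩
    exact sub_le_sub_right (hc ⟨n, rfl⟩) _

/-- The representative of the smaller class can be prescribed; this allows an increasing sequence of
classes to be lifted step by step to an increasing sequence of functions. -/
theorem exists_toQuot_eq_of_le {f : μ.L1} {v : μ.L1Quot} (h : μ.toQuot f ≤ v) :
    ∃ g : μ.L1, f ≤ g ∧ μ.toQuot g = v := by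
  obtain ⟨f', g, hfg, e, rfl⟩ := h
  refine ⟨f + (g - f'), fun x => ?_, by simp [e]⟩
  have h1 : (f' : X → ℝ) x ≤ (g : X → ℝ) x := hfg x
  change (f : X → ℝ) x ≤ (f : X → ℝ) x + ((g : X → ℝ) x - (f' : X → ℝ) x)
  linarith

theorem toQuot_surjective (μ : FiniteConeMeasure X E) : Function.Surjective μ.toQuot :=
  μ.null.mkQ_surjective

theorem integralQuot_toQuot (f : μ.L1) : μ.integralQuot (μ.toQuot f) = μ.integral f := rfl

end Complete

/-! ### Multiplicativity of the integral and its consequences for the order -/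

section Spectral

variable {X A : Type*} [MeasurableSpace X] [NonUnitalRing A] [Module ℝ A] [PartialOrder A]
  [PartiallyOrderedAlgebra A] {μ : FiniteConeMeasure X A}

/-- The intersections of the level sets of `φ` and `ψ` give a disjoint representation of `φ * ψ`,
and spectrality factors the measure of each intersection. -/
theorem simpleIntegral_mul (hμ : μ.IsSpectral) (φ ψ : SimpleFunc X ℝ≥0) :
    μ.simpleIntegral (φ * ψ) = μ.simpleIntegral φ * μ.simpleIntegral ψ := by
  rw [μ.simpleIntegral_eq_sum (φ * ψ) (φ.range ×ˢ ψ.range)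
    (S := fun p => φ ⁻¹' {p.1} ∩ ψ ⁻¹' {p.2})
    (fun p => (φ.measurableSet_fiber _).inter (ψ.measurableSet_fiber _)) ?_
    (fun p => p.1 * p.2) ?_ ?_]
  · rw [simpleIntegral, simpleIntegral, Finset.sum_mul_sum, Finset.sum_product]
    refine Finset.sum_congr rfl fun r _ => Finset.sum_congr rfl fun s _ => ?_
    rw [hμ _ _ (φ.measurableSet_fiber r) (ψ.measurableSet_fiber s), smul_mul_smul_comm,
      NNReal.coe_mul]
  · intro p _ q _ hpq
    rw [disjoint_left]
    rintro x ⟨hx₁, hx₂⟩ ⟨hx₃, hx₄⟩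
    exact hpq (Prod.ext (hx₁.symm.trans hx₃) (hx₂.symm.trans hx₄))
  · rintro p - x ⟨hx₁, hx₂⟩
    rw [← show φ x = p.1 from hx₁, ← show ψ x = p.2 from hx₂]
    rfl
  · exact fun x _ => ⟨(φ x, ψ x), Finset.mk_mem_product (SimpleFunc.mem_range_self _ _)
      (SimpleFunc.mem_range_self _ _), rfl, rfl⟩

theorem _root_.OrderInt.PartiallyOrderedAlgebra.mul_le_mul_left' {a b c : A} (hc : 0 ≤ c)
    (h : a ≤ b) : c * a ≤ c * b := by
  have := PartiallyOrderedAlgebra.mul_nonneg c (b - a) hc (sub_nonneg.2 h)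
  rwa [mul_sub, sub_nonneg] at this

theorem _root_.OrderInt.PartiallyOrderedAlgebra.mul_le_mul_right' {a b c : A} (hc : 0 ≤ c)
    (h : a ≤ b) : a * c ≤ b * c := by
  have := PartiallyOrderedAlgebra.mul_nonneg (b - a) c (sub_nonneg.2 h) hc
  rwa [sub_mul, sub_nonneg] at this

open PartiallyOrderedAlgebra (mul_le_mul_left' mul_le_mul_right')

/-- Continuity in each factor separately suffices, as the diagonal is cofinal: `x n * y m ≤ x k * y
k` for `k = max n m`. -/
theorem _root_.OrderInt.SigmaMonotoneContinuousMul.isLUB_mul (hA : SigmaMonotoneContinuousMul A)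
    {x y : ℕ → A} {a b : A} (hx : ∀ n, 0 ≤ x n) (hy : ∀ n, 0 ≤ y n) (hxm : Monotone x)
    (hym : Monotone y) (ha : IsLUB (range x) a) (hb : IsLUB (range y) b) :
    IsLUB (range fun n => x n * y n) (a * b) := by
  have hb0 : 0 ≤ b := (hy 0).trans (hb.1 ⟨0, rfl⟩)
  refine ⟨?_, fun c hc => ?_⟩
  · rintro _ ⟨n, rfl⟩
    exact (mul_le_mul_left' (hx n) (hb.1 ⟨n, rfl⟩)).trans (mul_le_mul_right' hb0 (ha.1 ⟨n, rfl⟩))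
  · refine (hA x a b hx hxm ha hb0).2.2.2 ?_
    rintro _ ⟨n, rfl⟩
    refine (hA y b (x n) hy hym hb (hx n)).1.2.2 ?_
    rintro _ ⟨m, rfl⟩
    exact ((mul_le_mul_left' (hx n) (hym (le_max_right n m))).trans
      (mul_le_mul_right' (hy _) (hxm (le_max_left n m)))).trans (hc ⟨max n m, rfl⟩)

theorem HasPosIntegral.mul (hA : SigmaMonotoneContinuousMul A) (hμ : μ.IsSpectral) {f g : X → ℝ}
    {a b : A} (hf : μ.HasPosIntegral f a) (hg : μ.HasPosIntegral g b) :
    μ.HasPosIntegral (fun x => f x * g x) (a * b) := by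
  obtain ⟨φ, hφ, ha⟩ := hf
  obtain ⟨ψ, hψ, hb⟩ := hg
  refine ⟨fun n => φ n * ψ n, ⟨fun m n h x => mul_le_mul' (hφ.1 h x) (hψ.1 h x), fun x => ?_⟩, ?_⟩
  · simpa using (hφ.2 x).mul (hψ.2 x)
  · simp only [simpleIntegral_mul hμ]
    exact hA.isLUB_mul (fun _ => μ.simpleIntegral_nonneg _) (fun _ => μ.simpleIntegral_nonneg _)
      (fun _ _ h => μ.simpleIntegral_mono (hφ.1 h)) (fun _ _ h => μ.simpleIntegral_mono (hψ.1 h))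
      ha hb

variable [SigmaMonotoneComplete A]

theorem mul_mem (hA : SigmaMonotoneContinuousMul A) (hμ : μ.IsSpectral) {f g : X → ℝ}
    (hf : f ∈ μ.L1) (hg : g ∈ μ.L1) : f * g ∈ μ.L1 := by
  obtain ⟨hf, a, ha⟩ := hf
  obtain ⟨hg, b, hb⟩ := hg
  exact ⟨hf.mul hg, a * b, by simpa only [Pi.mul_apply, abs_mul] using ha.mul hA hμ hb⟩

/-- Expand `(f⁺ - f⁻)(g⁺ - g⁻)` and use the positive case. Leaving `h` free up to its underlying
function lets one pointwise product be read in either order, so that `exists_integral_sup_eq` can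
place `μ S` on either side. -/
theorem integral_mul (hA : SigmaMonotoneContinuousMul A) (hμ : μ.IsSpectral) {f g h : μ.L1}
    (e : (h : X → ℝ) = f * g) : μ.integral h = μ.integral f * μ.integral g := by
  have hf := hasPosIntegral_pos f.2
  have hf' := hasPosIntegral_pos (neg_mem f.2)
  have hg := hasPosIntegral_pos g.2
  have hg' := hasPosIntegral_pos (neg_mem g.2)
  have ef : ∀ x, (f : X → ℝ) x = max ((f : X → ℝ) x) 0 - max (-(f : X → ℝ) x) 0 := fun x =>
    (max_zero_sub_eq_self _).symm
  have eg : ∀ x, (g : X → ℝ) x = max ((g : X → ℝ) x) 0 - max (-(g : X → ℝ) x) 0 := fun x =>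
    (max_zero_sub_eq_self _).symm
  rw [integral_eq_sub hf hf' ef, integral_eq_sub hg hg' eg,
    integral_eq_sub ((hf.mul hA hμ hg).add (hf'.mul hA hμ hg'))
      ((hf.mul hA hμ hg').add (hf'.mul hA hμ hg)) fun x => ?_]
  · simp only [sub_mul, mul_sub]
    abel
  · rw [e]
    have h1 := congrArg₂ (· * ·) (ef x) (eg x)
    simp only [Pi.mul_apply, Pi.neg_apply] at h1 ⊢
    rw [h1]
    ring

theorem exists_indicator (μ : FiniteConeMeasure X A) {S : Set X} (hS : MeasurableSet S) :
    ∃ e : μ.L1, (e : X → ℝ) = S.indicator 1 ∧ μ.integral e = μ S :=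
  ⟨⟨_, (μ.hasPosIntegral_indicator hS).mem_L1⟩, rfl,
    HasPosIntegral.integral_eq (μ.hasPosIntegral_indicator hS)⟩

theorem measure_univ_mul_integral (hA : SigmaMonotoneContinuousMul A) (hμ : μ.IsSpectral)
    (f : μ.L1) : μ univ * μ.integral f = μ.integral f := by
  obtain ⟨e, he, hI⟩ := μ.exists_indicator MeasurableSet.univ
  rw [← hI, ← integral_mul hA hμ (h := f) (by simp [he])]

theorem integral_mul_measure_univ (hA : SigmaMonotoneContinuousMul A) (hμ : μ.IsSpectral)
    (f : μ.L1) : μ.integral f * μ univ = μ.integral f := by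
  obtain ⟨e, he, hI⟩ := μ.exists_indicator MeasurableSet.univ
  rw [← hI, ← integral_mul hA hμ (h := f) (by simp [he])]

/-- For `S = {g ≤ f}`, the supremum is `χ_S f + χ_{Sᶜ} g`. -/
theorem exists_integral_sup_eq (hA : SigmaMonotoneContinuousMul A) (hμ : μ.IsSpectral)
    (f g : μ.L1) : ∃ S, MeasurableSet S ∧
      μ.integral (sup f g) = μ S * μ.integral f + μ Sᶜ * μ.integral g ∧
      μ.integral (sup f g) = μ.integral f * μ S + μ.integral g * μ Sᶜ := by
  have hS : MeasurableSet {x | (g : X → ℝ) x ≤ (f : X → ℝ) x} := measurableSet_le g.2.1 f.2.1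
  refine ⟨_, hS, ?_⟩
  set S := {x | (g : X → ℝ) x ≤ (f : X → ℝ) x}
  obtain ⟨u, hu, hIu⟩ := μ.exists_indicator hS
  obtain ⟨v, hv, hIv⟩ := μ.exists_indicator hS.compl
  let p : μ.L1 := ⟨_, mul_mem hA hμ u.2 f.2⟩
  let q : μ.L1 := ⟨_, mul_mem hA hμ v.2 g.2⟩
  have e : sup f g = p + q := by
    refine Subtype.ext (funext fun x => ?_)
    change max ((f : X → ℝ) x) ((g : X → ℝ) x) =
      (u : X → ℝ) x * (f : X → ℝ) x + (v : X → ℝ) x * (g : X → ℝ) x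
    rw [hu, hv]
    by_cases hx : (g : X → ℝ) x ≤ (f : X → ℝ) x
    · have : x ∈ S := hx
      simp [this, hx]
    · have : x ∉ S := hx
      simp [this, (not_le.1 hx).le]
  rw [e, map_add, ← hIu, ← hIv]
  exact ⟨by rw [integral_mul hA hμ (h := p) rfl, integral_mul hA hμ (h := q) rfl],
    by rw [integral_mul hA hμ (h := p) (mul_comm _ _), integral_mul hA hμ (h := q) (mul_comm _ _)]⟩

/-- Multiplying the bounds by `μ S` and `μ Sᶜ` and adding gives `μ S * b + μ Sᶜ * b = μ univ * b =
b`. -/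
theorem integral_sup_le_of_mul_left (hA : SigmaMonotoneContinuousMul A) (hμ : μ.IsSpectral)
    {f g : μ.L1} {b : A} (hb : μ univ * b = b) (hf : μ.integral f ≤ b) (hg : μ.integral g ≤ b) :
    μ.integral (sup f g) ≤ b := by
  obtain ⟨S, hS, h, -⟩ := exists_integral_sup_eq hA hμ f g
  rw [h, ← hb, ← μ.measure_add_compl hS, add_mul]
  exact add_le_add (mul_le_mul_left' (μ.nonneg _ hS) hf) (mul_le_mul_left' (μ.nonneg _ hS.compl) hg)

theorem integral_sup_le_of_mul_right (hA : SigmaMonotoneContinuousMul A) (hμ : μ.IsSpectral)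
    {f g : μ.L1} {b : A} (hb : b * μ univ = b) (hf : μ.integral f ≤ b) (hg : μ.integral g ≤ b) :
    μ.integral (sup f g) ≤ b := by
  obtain ⟨S, hS, -, h⟩ := exists_integral_sup_eq hA hμ f g
  rw [h, ← hb, ← μ.measure_add_compl hS, mul_add]
  exact add_le_add (mul_le_mul_right' (μ.nonneg _ hS) hf)
    (mul_le_mul_right' (μ.nonneg _ hS.compl) hg)

/-- The element `b = I(g)` is itself fixed by `μ univ`, so it is an admissible bound. -/
theorem integral_sup_eq_right (hA : SigmaMonotoneContinuousMul A) (hμ : μ.IsSpectral)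
    {f g : μ.L1} (h : μ.integral f ≤ μ.integral g) : μ.integral (sup f g) = μ.integral g :=
  (integral_sup_le_of_mul_left hA hμ (measure_univ_mul_integral hA hμ g) h le_rfl).antisymm
    (integral_mono ((isLUB_sup f g).1 (by simp)))

theorem integral_inf_eq_left (hA : SigmaMonotoneContinuousMul A) (hμ : μ.IsSpectral)
    {f g : μ.L1} (h : μ.integral f ≤ μ.integral g) : μ.integral (inf f g) = μ.integral f := by
  have := congrArg μ.integral (inf_add_sup f g)
  rw [map_add, map_add, integral_sup_eq_right hA hμ h] at this
  exact add_right_cancel this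

/-- If `I(f) = 0`, then `I(f) ≤ I(-f)`, so `|f| = f ∨ (-f)` has integral `I(-f) = 0`. -/
theorem ker_integral (hA : SigmaMonotoneContinuousMul A) (hμ : μ.IsSpectral) :
    LinearMap.ker μ.integral = μ.null := by
  refine le_antisymm (fun f hf => ?_) μ.null_le_ker
  have hf0 : μ.integral f = 0 := hf
  have h1 : μ.integral (sup f (-f)) = 0 := by
    rw [integral_sup_eq_right hA hμ (by simp [hf0]), map_neg, hf0, neg_zero]
  have h2 := hasPosIntegral_integral (μ := μ) (f := sup f (-f)) fun x => abs_nonneg _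
  rw [h1] at h2
  have h3 := h2.measure_ne_zero
  have e : {x | (sup f (-f) : X → ℝ) x ≠ 0} = {x | (f : X → ℝ) x ≠ 0} := by
    ext x
    exact abs_ne_zero (a := (f : X → ℝ) x)
  rwa [e] at h3

/-- If `I(f) ≤ I(g)`, then `f ∨ g` and `g` have the same integral, so they differ by a null
function; thus `f ∨ g` is a representative of the class of `g` that lies above `f`. -/
theorem integralQuot_le_iff (hA : SigmaMonotoneContinuousMul A) (hμ : μ.IsSpectral)
    (u v : μ.L1Quot) : μ.integralQuot u ≤ μ.integralQuot v ↔ u ≤ v := by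
  constructor
  · obtain ⟨f, rfl⟩ := μ.toQuot_surjective u
    obtain ⟨g, rfl⟩ := μ.toQuot_surjective v
    intro h
    refine ⟨f, sup f g, (isLUB_sup f g).1 (by simp), rfl, (Submodule.Quotient.eq _).2 ?_⟩
    rw [← ker_integral hA hμ, LinearMap.mem_ker, map_sub, integral_sup_eq_right hA hμ h, sub_self]
  · rintro ⟨f, g, h, rfl, rfl⟩
    exact integral_mono h

theorem sigmaClosedRange_integralQuot (hA : SigmaMonotoneContinuousMul A) (hμ : μ.IsSpectral) :
    SigmaClosedRange μ.integralQuot := by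
  intro u hu ⟨v, hv⟩
  obtain ⟨g, rfl⟩ := μ.toQuot_surjective v
  obtain ⟨f₀, hf₀⟩ := μ.toQuot_surjective (u 0)
  have hstep : ∀ n, ∀ f : {f : μ.L1 // μ.toQuot f = u n},
      ∃ h : {f : μ.L1 // μ.toQuot f = u (n + 1)}, f.1 ≤ h.1 := by
    rintro n ⟨f, hf⟩
    obtain ⟨h, hfh, e⟩ := exists_toQuot_eq_of_le (f := f) (hf.le.trans (hu (Nat.le_succ n)))
    exact ⟨⟨h, e⟩, hfh⟩
  choose J hJ using hstep
  let q : ∀ n, {f : μ.L1 // μ.toQuot f = u n} := fun n => Nat.rec ⟨f₀, hf₀⟩ J n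
  have hq : Monotone fun n => (q n).1 := monotone_nat_of_le_succ fun n => hJ n (q n)
  -- The bound on the classes only holds almost everywhere for representatives; the infimum with `g`
  -- makes it pointwise and leaves the integrals unchanged.
  obtain ⟨h, hh⟩ := exists_isLUB_integral (μ := μ) (f := fun n => inf (q n).1 g) (g := g)
    (fun m n hmn x => inf_le_inf_right _ (hq hmn x)) (fun n => (isGLB_inf _ g).1 (by simp))
  refine ⟨μ.toQuot h, ?_⟩
  rw [← range_comp, integralQuot_toQuot]
  convert hh using 3 with n
  rw [integral_inf_eq_left hA hμ]
  · exact congrArg μ.integralQuot (q n).2.symm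
  rw [← integralQuot_toQuot, ← integralQuot_toQuot, integralQuot_le_iff hA hμ, (q n).2]
  exact hv ⟨n, rfl⟩

end Spectral

end FiniteConeMeasure

/-! ### Transport of structure along order embeddings and isomorphisms -/

section Embedding

variable {E F : Type*} [AddCommGroup E] [Module ℝ E] [PartialOrder E]
  [AddCommGroup F] [Module ℝ F] [PartialOrder F]

theorem PartiallyOrderedVectorSpace.of_embedding [PartiallyOrderedVectorSpace F] {T : E →ₗ[ℝ] F}
    (hT : ∀ u v, T u ≤ T v ↔ u ≤ v) : PartiallyOrderedVectorSpace E where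
  add_le_add_left a b h c := by
    rw [← hT, map_add, map_add]
    exact add_le_add_left ((hT _ _).2 h) _
  smul_le_smul_of_nonneg_left c hc a b h := by
    rw [← hT, map_smul, map_smul]
    exact smul_le_smul_of_nonneg_left ((hT _ _).2 h) hc
  smul_le_smul_of_nonneg_right a ha c d h := by
    rw [← hT, map_smul, map_smul]
    exact smul_le_smul_of_nonneg_right h (by simpa using (hT 0 a).2 ha)
  archimedean x hx r hr h0 := by
    have hx' : 0 ≤ T x := by simpa using (hT 0 x).2 hx
    have h := PartiallyOrderedVectorSpace.archimedean (T x) hx' r hr h0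
    refine ⟨?_, fun y hy => (hT _ _).1 ?_⟩
    · rintro _ ⟨n, rfl⟩
      rw [← hT, map_zero, map_smul]
      exact h.1 ⟨n, rfl⟩
    · rw [map_zero]
      refine h.2 ?_
      rintro _ ⟨n, rfl⟩
      have := (hT _ _).2 (hy ⟨n, rfl⟩)
      rwa [map_smul] at this

theorem partiallyOrderedVectorSpace_pi (X : Type*) : PartiallyOrderedVectorSpace (X → ℝ) where
  archimedean f hf r hr h0 := by
    have hl : Tendsto r atTop (𝓝 0) := tendsto_atTop_isGLB hr h0
    refine ⟨?_, fun g hg x => ?_⟩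
    · rintro _ ⟨n, rfl⟩
      exact smul_nonneg (h0.1 ⟨n, rfl⟩) hf
    · refine ge_of_tendsto' (x := atTop) (f := fun n => r n * f x) ?_ fun n => hg ⟨n, rfl⟩ x
      simpa using hl.mul_const (f x)

theorem IsRieszSpace.of_exists_sup (h : PartiallyOrderedVectorSpace E)
    (hE : ∀ x y : E, ∃ z, IsLUB {x, y} z) : IsRieszSpace E where
  povs := h
  exists_sup := hE
  exists_inf x y := by
    obtain ⟨z, hz⟩ := hE (-x) (-y)
    refine ⟨-z, isLUB_neg'.1 ?_⟩
    rwa [neg_neg, ← Set.image_neg_eq_neg, image_pair]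

theorem PreservesLatticeStructure.of_equiv {Φ : E ≃ₗ[ℝ] F} (hΦ : ∀ u v, Φ u ≤ Φ v ↔ u ≤ v) :
    PreservesLatticeStructure Φ.toLinearMap := by
  intro x y z h
  refine isLUB_of_isLUB_image (T := Φ.symm.toLinearMap) (fun u v => ?_) ?_
  · simpa using (hΦ (Φ.symm u) (Φ.symm v)).symm
  · rw [image_pair]
    simpa using h

/-- The structure of a commutative unital Riesz algebra, transported along an order
isomorphism. -/
theorem IsCommUnitalRieszAlgebra.of_equiv {m : F →ₗ[ℝ] F →ₗ[ℝ] F} {e : F}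
    (h : IsCommUnitalRieszAlgebra m e) {Φ : E ≃ₗ[ℝ] F} (hΦ : ∀ u v, Φ u ≤ Φ v ↔ u ≤ v) :
    IsCommUnitalRieszAlgebra
      ((m.compl₁₂ Φ.toLinearMap Φ.toLinearMap).compr₂ Φ.symm.toLinearMap) (Φ.symm e) where
  riesz := by
    have := h.riesz.povs
    refine .of_exists_sup (.of_embedding (T := Φ.toLinearMap) hΦ) fun x y => ?_
    obtain ⟨z, hz⟩ := h.riesz.exists_sup (Φ x) (Φ y)
    refine ⟨Φ.symm z, isLUB_of_isLUB_image (T := Φ.toLinearMap) hΦ ?_⟩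
    rw [image_pair]
    simpa using hz
  assoc a b c := by simp [h.assoc]
  comm a b := by simp [h.comm (Φ a)]
  mul_nonneg a b ha hb := by
    rw [← hΦ, map_zero] at ha hb ⊢
    simpa using h.mul_nonneg _ _ ha hb
  one_mul a := by simp [h.one_mul]
  one_nonneg := by
    rw [← hΦ]
    simpa using h.one_nonneg

end Embedding

namespace FiniteConeMeasure

/-! ### The Riesz algebras `𝓛¹`, its image, and `L¹` -/

section Multiplication

variable {X A : Type*} [MeasurableSpace X] [NonUnitalRing A] [Module ℝ A] [PartialOrder A]
  [PartiallyOrderedAlgebra A] [SigmaMonotoneComplete A] {μ : FiniteConeMeasure X A}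

/-- The pointwise multiplication on `𝓛¹`. -/
noncomputable def mulL1 (hA : SigmaMonotoneContinuousMul A) (hμ : μ.IsSpectral) :
    μ.L1 →ₗ[ℝ] μ.L1 →ₗ[ℝ] μ.L1 :=
  LinearMap.mk₂ ℝ (fun f g => ⟨f * g, mul_mem hA hμ f.2 g.2⟩)
    (fun _ _ _ => Subtype.ext (add_mul _ _ _)) (fun _ _ _ => Subtype.ext (smul_mul_assoc _ _ _))
    (fun _ _ _ => Subtype.ext (mul_add _ _ _)) (fun _ _ _ => Subtype.ext (mul_smul_comm _ _ _))

theorem integral_mulL1 (hA : SigmaMonotoneContinuousMul A) (hμ : μ.IsSpectral) (f g : μ.L1) :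
    μ.integral (mulL1 hA hμ f g) = μ.integral f * μ.integral g :=
  integral_mul hA hμ rfl

/-- The multiplication of `A`, restricted to the image of the integral operator. -/
noncomputable def mulRange (hA : SigmaMonotoneContinuousMul A) (hμ : μ.IsSpectral) :
    LinearMap.range μ.integral →ₗ[ℝ] LinearMap.range μ.integral →ₗ[ℝ] LinearMap.range μ.integral :=
  LinearMap.mk₂ ℝ (fun a b => ⟨a * b, by
      obtain ⟨f, hf⟩ := a.2
      obtain ⟨g, hg⟩ := b.2
      exact ⟨mulL1 hA hμ f g, by rw [integral_mulL1, hf, hg]⟩⟩)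
    (fun _ _ _ => Subtype.ext (add_mul _ _ _)) (fun _ _ _ => Subtype.ext (smul_mul_assoc _ _ _))
    (fun _ _ _ => Subtype.ext (mul_add _ _ _)) (fun _ _ _ => Subtype.ext (mul_smul_comm _ _ _))

/-- Only upper bounds in `V` compete for a supremum in `V`. This serves `μ(X) A`, `A μ(X)` and the
image of the integral alike. -/
theorem preservesLatticeStructure_of_forall_le {V : Submodule ℝ A} {T : μ.L1 →ₗ[ℝ] V}
    (hT : ∀ f, (T f : A) = μ.integral f)
    (hV : ∀ b ∈ V, ∀ f g : μ.L1, μ.integral f ≤ b → μ.integral g ≤ b →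
      μ.integral (sup f g) ≤ b) : PreservesLatticeStructure T := by
  intro f g h hfg
  have hle : ∀ {p q : μ.L1}, p ≤ q → T p ≤ T q := fun {p q} hpq => by
    rw [← Subtype.coe_le_coe, hT, hT]
    exact integral_mono hpq
  rw [hfg.unique (isLUB_sup f g)]
  refine ⟨?_, fun b hb => ?_⟩
  · rintro _ (rfl | rfl)
    exacts [hle ((isLUB_sup f g).1 (by simp)), hle ((isLUB_sup f g).1 (by simp))]
  · have h1 : T f ≤ b := hb (by simp)
    have h2 : T g ≤ b := hb (by simp)
    rw [← Subtype.coe_le_coe, hT] at h1 h2 ⊢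
    exact hV b b.2 f g h1 h2

theorem preservesLatticeStructure_rangeRestrict (hA : SigmaMonotoneContinuousMul A)
    (hμ : μ.IsSpectral) : PreservesLatticeStructure μ.integral.rangeRestrict := by
  refine preservesLatticeStructure_of_forall_le (fun _ => rfl) ?_
  rintro _ ⟨h, rfl⟩ f g
  exact integral_sup_le_of_mul_left hA hμ (measure_univ_mul_integral hA hμ h)

theorem isCommUnitalRieszAlgebra_mulL1 (hA : SigmaMonotoneContinuousMul A) (hμ : μ.IsSpectral)
    {e : μ.L1} (he : (e : X → ℝ) = 1) : IsCommUnitalRieszAlgebra (mulL1 hA hμ) e where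
  riesz := by
    have := partiallyOrderedVectorSpace_pi X
    exact ⟨.of_embedding (T := μ.L1.subtype) fun _ _ => Iff.rfl, fun f g => ⟨_, isLUB_sup f g⟩,
      fun f g => ⟨_, isGLB_inf f g⟩⟩
  assoc _ _ _ := Subtype.ext (mul_assoc _ _ _)
  comm _ _ := Subtype.ext (mul_comm _ _)
  mul_nonneg _ _ hf hg x := mul_nonneg (hf x) (hg x)
  one_mul f := Subtype.ext (by
    change (e : X → ℝ) * f = f
    rw [he, one_mul])
  one_nonneg x := by
    rw [he]
    exact zero_le_one

/-- The algebraic identities and the suprema are pushed forward from `𝓛¹` along the surjection onto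
the image. -/
theorem isCommUnitalRieszAlgebra_mulRange (hA : SigmaMonotoneContinuousMul A) (hμ : μ.IsSpectral)
    {e : μ.L1} (he : (e : X → ℝ) = 1) :
    IsCommUnitalRieszAlgebra (mulRange hA hμ) (μ.integral.rangeRestrict e) := by
  have h := isCommUnitalRieszAlgebra_mulL1 hA hμ he
  have hs := μ.integral.surjective_rangeRestrict
  have hmul : ∀ f g, mulRange hA hμ (μ.integral.rangeRestrict f) (μ.integral.rangeRestrict g) =
      μ.integral.rangeRestrict (mulL1 hA hμ f g) := fun f g =>
    Subtype.ext (integral_mulL1 hA hμ f g).symm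
  refine ⟨.of_exists_sup (.of_embedding (T := (LinearMap.range μ.integral).subtype)
    fun _ _ => Iff.rfl) ?_, ?_, ?_, ?_, ?_, integral_nonneg h.one_nonneg⟩
  · exact hs.forall₂.2 fun f g =>
      ⟨_, preservesLatticeStructure_rangeRestrict hA hμ f g _ (isLUB_sup f g)⟩
  · exact hs.forall₃.2 fun f g k => by simp only [hmul, h.assoc]
  · exact hs.forall₂.2 fun f g => by simp only [hmul, h.comm f g]
  · exact fun a b ha hb => PartiallyOrderedAlgebra.mul_nonneg (a : A) b ha hb
  · exact hs.forall.2 fun f => by simp only [hmul, h.one_mul]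

/-- The isomorphism from `L¹` onto the image of the integral operator. -/
noncomputable def quotEquivRange (hA : SigmaMonotoneContinuousMul A) (hμ : μ.IsSpectral) :
    μ.L1Quot ≃ₗ[ℝ] LinearMap.range μ.integral :=
  LinearEquiv.ofBijective (μ.integralQuot.codRestrict (LinearMap.range μ.integral) fun u => by
      obtain ⟨f, rfl⟩ := μ.toQuot_surjective u
      exact ⟨f, rfl⟩) ⟨fun u v h => by
      have h' : μ.integralQuot u = μ.integralQuot v := congrArg Subtype.val h
      exact le_antisymm ((integralQuot_le_iff hA hμ u v).1 h'.le)
        ((integralQuot_le_iff hA hμ v u).1 h'.ge), by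
      rintro ⟨_, f, rfl⟩
      exact ⟨μ.toQuot f, rfl⟩⟩

end Multiplication

end FiniteConeMeasure

end OrderInt

/-! ### The main theorem -/

theorem mainTheorem5 {X A : Type*} [MeasurableSpace X] [NonUnitalRing A] [Module ℝ A]
    [PartialOrder A] [OrderInt.PartiallyOrderedAlgebra A] [OrderInt.SigmaMonotoneComplete A]
    (hA : OrderInt.SigmaMonotoneContinuousMul A)
    (μ : OrderInt.FiniteConeMeasure X A) (hμ : μ.IsSpectral) :
    -- the integrals are in `μ(X) A μ(X)`
    (∀ f : μ.L1, ∃ a : A, μ.integral f = μ univ * a * μ univ) ∧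
    -- the integral operator preserves the lattice structure as a map into `μ(X) A`
    (∃ T : μ.L1 →ₗ[ℝ] LinearMap.range (LinearMap.mulLeft ℝ (μ univ)),
      (∀ f, (T f : A) = μ.integral f) ∧ OrderInt.PreservesLatticeStructure T) ∧
    -- the integral operator preserves the lattice structure as a map into `A μ(X)`
    (∃ T : μ.L1 →ₗ[ℝ] LinearMap.range (LinearMap.mulRight ℝ (μ univ)),
      (∀ f, (T f : A) = μ.integral f) ∧ OrderInt.PreservesLatticeStructure T) ∧
    -- the multiplications `mL`, `mB`, `mQ` and the identities `eL`, `eB`, `eQ` of `𝓛¹`, of the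
    -- image of the integral operator, and of `L¹`
    (∃ (mL : μ.L1 →ₗ[ℝ] μ.L1 →ₗ[ℝ] μ.L1) (eL : μ.L1)
      (mB : LinearMap.range μ.integral →ₗ[ℝ] LinearMap.range μ.integral →ₗ[ℝ]
        LinearMap.range μ.integral) (eB : LinearMap.range μ.integral)
      (mQ : μ.L1Quot →ₗ[ℝ] μ.L1Quot →ₗ[ℝ] μ.L1Quot) (eQ : μ.L1Quot),
      -- `𝓛¹` is a commutative unital Riesz algebra for the pointwise operations
      ((∀ f g : μ.L1, (mL f g : X → ℝ) = (f : X → ℝ) * (g : X → ℝ)) ∧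
        (eL : X → ℝ) = 1 ∧
        (∀ f g : μ.L1, (f : X → ℝ) ⊔ (g : X → ℝ) ∈ μ.L1 ∧ (f : X → ℝ) ⊓ (g : X → ℝ) ∈ μ.L1) ∧
        OrderInt.IsCommUnitalRieszAlgebra mL eL) ∧
      -- the image is a commutative unital Riesz algebra with identity `μ(X)`, for the
      -- multiplication and the ordering of `A`, and the integral operator is a surjective unital
      -- Riesz algebra homomorphism onto it
      ((∀ a b : LinearMap.range μ.integral, (mB a b : A) = (a : A) * (b : A)) ∧
        (eB : A) = μ univ ∧
        OrderInt.IsCommUnitalRieszAlgebra mB eB ∧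
        OrderInt.IsUnitalRieszAlgebraHom mL eL mB eB μ.integral.rangeRestrict ∧
        Function.Surjective μ.integral.rangeRestrict) ∧
      -- `L¹` is a commutative unital Riesz algebra as a quotient of `𝓛¹`, and the induced operator
      -- is an isomorphism of Riesz algebras from `L¹` onto the image
      (OrderInt.IsCommUnitalRieszAlgebra mQ eQ ∧
        OrderInt.IsUnitalRieszAlgebraHom mL eL mQ eQ μ.toQuot ∧
        ∃ Φ : μ.L1Quot ≃ₗ[ℝ] LinearMap.range μ.integral,
          (∀ u, (Φ u : A) = μ.integralQuot u) ∧
          OrderInt.IsUnitalRieszAlgebraHom mQ eQ mB eB Φ.toLinearMap ∧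
          OrderInt.IsUnitalRieszAlgebraHom mB eB mQ eQ Φ.symm.toLinearMap)) ∧
    -- the kernel of the integral operator
    LinearMap.ker μ.integral = μ.null ∧
    -- completeness and order continuity
    OrderInt.SigmaDedekindComplete μ.L1Quot ∧
    OrderInt.IsPositiveSigmaOrderContinuous μ.integralQuot ∧
    (OrderInt.MonotoneComplete A → OrderInt.CountableSupProperty A →
      OrderInt.DedekindComplete μ.L1Quot ∧
      OrderInt.CountableSupProperty μ.L1Quot ∧
      OrderInt.IsPositiveOrderContinuous μ.integralQuot) := by
  have hle := OrderInt.FiniteConeMeasure.integralQuot_le_iff hA hμ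
  have hσ := OrderInt.FiniteConeMeasure.sigmaClosedRange_integralQuot hA hμ
  have hl := OrderInt.FiniteConeMeasure.measure_univ_mul_integral hA hμ
  have hr := OrderInt.FiniteConeMeasure.integral_mul_measure_univ hA hμ
  have hidem : μ univ * μ univ = μ univ := by
    rw [← hμ _ _ MeasurableSet.univ MeasurableSet.univ, inter_self]
  obtain ⟨e, he, hIe⟩ := μ.exists_indicator MeasurableSet.univ
  rw [indicator_univ] at he
  have hL := OrderInt.FiniteConeMeasure.isCommUnitalRieszAlgebra_mulL1 hA hμ he
  have hB := OrderInt.FiniteConeMeasure.isCommUnitalRieszAlgebra_mulRange hA hμ he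
  have hBL := OrderInt.FiniteConeMeasure.preservesLatticeStructure_rangeRestrict hA hμ
  let Φ := OrderInt.FiniteConeMeasure.quotEquivRange hA hμ
  have hΦ : ∀ u v, Φ u ≤ Φ v ↔ u ≤ v := hle
  have hΦq : ∀ f, Φ (μ.toQuot f) = μ.integral.rangeRestrict f := fun _ => rfl
  -- The multiplication on `L¹` is the one of the image, pulled back along `Φ`; its agreement with
  -- the quotient of the pointwise product is checked below, after applying the injective map `Φ`.
  have hQ := hB.of_equiv hΦ
  have hQsup := hQ.riesz.exists_sup
  have := hQ.riesz.povs
  refine ⟨fun f => ⟨μ.integral f, by rw [hl, hr]⟩,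
    ⟨μ.integral.codRestrict _ fun f => ⟨μ.integral f, hl f⟩, fun _ => rfl, ?_⟩,
    ⟨μ.integral.codRestrict _ fun f => ⟨μ.integral f, hr f⟩, fun _ => rfl, ?_⟩,
    ⟨OrderInt.FiniteConeMeasure.mulL1 hA hμ, e, OrderInt.FiniteConeMeasure.mulRange hA hμ,
      μ.integral.rangeRestrict e, _, _,
      ⟨fun _ _ => rfl, he, fun f g => ⟨OrderInt.FiniteConeMeasure.sup_mem f g,
        OrderInt.FiniteConeMeasure.inf_mem f g⟩, hL⟩,
      ⟨fun _ _ => rfl, hIe, hB, ⟨hBL, fun f g =>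
        Subtype.ext (OrderInt.FiniteConeMeasure.integral_mulL1 hA hμ f g), rfl⟩,
        μ.integral.surjective_rangeRestrict⟩,
      hQ, ⟨?_, fun f g => ?_, ?_⟩, Φ, fun _ => rfl, ⟨.of_equiv hΦ, ?_, ?_⟩,
      ⟨.of_equiv fun u v => ?_, ?_, ?_⟩⟩,
    OrderInt.FiniteConeMeasure.ker_integral hA hμ,
    OrderInt.sigmaDedekindComplete_of_embedding hle hQsup hσ,
    OrderInt.isPositiveSigmaOrderContinuous_of_embedding hle hσ,
    fun hm hc => ⟨OrderInt.dedekindComplete_of_embedding hle hQsup hσ hm hc,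
      OrderInt.countableSupProperty_of_embedding hle hσ hm hc,
      OrderInt.isPositiveOrderContinuous_of_embedding hle hσ hm hc⟩⟩
  · refine OrderInt.FiniteConeMeasure.preservesLatticeStructure_of_forall_le (fun _ => rfl) ?_
    rintro _ ⟨b, rfl⟩ f g
    refine OrderInt.FiniteConeMeasure.integral_sup_le_of_mul_left hA hμ ?_
    -- Elements of `μ(X) A` are fixed by `μ(X)` because `μ(X)` is idempotent.
    rw [LinearMap.mulLeft_apply, ← mul_assoc, hidem]
  · refine OrderInt.FiniteConeMeasure.preservesLatticeStructure_of_forall_le (fun _ => rfl) ?_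
    rintro _ ⟨b, rfl⟩ f g
    refine OrderInt.FiniteConeMeasure.integral_sup_le_of_mul_right hA hμ ?_
    rw [LinearMap.mulRight_apply, mul_assoc, hidem]
  · intro f g h hfg
    -- `Φ` reflects suprema, and its composition with the quotient map is the integral, which
    -- preserves them.
    refine OrderInt.isLUB_of_isLUB_image (T := Φ.toLinearMap) hΦ ?_
    rw [image_pair]
    exact hBL f g h hfg
  · refine Φ.injective ?_
    rw [LinearMap.compr₂_apply, LinearEquiv.coe_coe, LinearEquiv.apply_symm_apply]
    exact Subtype.ext (OrderInt.FiniteConeMeasure.integral_mulL1 hA hμ f g)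
  · exact (LinearEquiv.eq_symm_apply Φ).2 rfl
  · exact fun u v => Φ.apply_symm_apply _
  · exact Φ.apply_symm_apply _
  · simpa using (hΦ (Φ.symm u) (Φ.symm v)).symm
  · intro a b
    simp
  · rfl
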